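/- Let $d\ge 1$. A hyperplane in $\mathbb{R}^d$ is a set $\{x : \langle a,x\rangle=c\}$ with $a\in\mathbb{R}^d\setminus\{0\}$, $c\in\mathbb{R}$. A tour is a closed polyline with at least one corner (a single point is allowed); $|T|$ denotes its Euclidean length. A tour of a point set is a tour that contains every point of the set. A tour is feasible for a set $\mathcal{I}$ of hyperplanes if it contains a point of every hyperplane in $\mathcal{I}$, and it is optimal for $\mathcal{I}$ if it has minimum length among the feasible tours. For a set $\mathcal{H}$ of hyperplanes let $\pm\mathcal{H}$ be the set of all closed half-spaces bordered by hyperplanes of $\mathcal{H}$ (two for each hyperplane), and let $\mathrm{Polytopes}(\mathcal{H})$ be the collection of all bounded sets of the form $\bigcap_{s\in\pm\mathcal{H}}(\tau_s+s)$ with translation vectors $\tau_s\in\mathbb{R}^d$. For $\varepsilon>0$ let $$k_{\varepsilon,d}=\Bigl(\Bigl\lceil \tfrac{2\pi}{\arctan(\varepsilon/\sqrt{d^2-1})}\Bigr\rceil\sqrt d\Bigr)^{d-1}\quad(\text{with }k_{\varepsilon,1}=1),\qquad g=\frac{\varepsilon}{k_{\varepsilon,d}\,\sqrt d\,(2^d+1)},$$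 and let $G=\{g z : z\in\{0,1,\dots,\lceil 1/g\rceil\}^d\}$ be the set of points of the grid of granularity $g$ that covers the unit cube $[0,1]^d$. Let $\mathcal{H}_{\varepsilon,d}$ be the (finite) set of all hyperplanes $h$ for which there are $d$ points in $G$ such that $h$ is the only hyperplane containing all of them. Lemma 3.6. Let $\varepsilon>0$ and let $\mathcal{I}$ be a finite set of hyperplanes in $\mathbb{R}^d$. Then an optimal tour for $\mathcal{I}$ exists, and there is a nonempty polytope $P\in\mathrm{Polytopes}(\mathcal{H}_{\varepsilon,d})$ such that the set of vertices of $P$ has a shortest tour, and every shortest tour $T'$ of the vertices of $P$ is feasible for $\mathcal{I}$ and satisfies $|T'|\le(1+\varepsilon)\,|T|$ for every optimal tour $T$ for $\mathcal{I}$. -/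

import Mathlib

namespace HyperplaneTSPN

open Real

/-- The Euclidean space `ℝᵈ`. -/
abbrev E (d : ℕ) : Type := EuclideanSpace ℝ (Fin d)

/-- The set of points `x` with `⟨a, x⟩ = c`; a hyperplane if `a ≠ 0`. -/
def level {d : ℕ} (a : E d) (c : ℝ) : Set (E d) := {x | inner ℝ a x = c}

/-- The set of points `x` with `⟨a, x⟩ ≤ c`; if `a ≠ 0`, this is a closed half-space
bordered by `level a c`, and `lower (-a) (-c)` is the opposite one. -/
def lower {d : ℕ} (a : E d) (c : ℝ) : Set (E d) := {x | inner ℝ a x ≤ c}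

/-- Hyperplanes of `ℝᵈ` (not necessarily through the origin). -/
def IsHyperplane {d : ℕ} (h : Set (E d)) : Prop :=
  ∃ (a : E d) (c : ℝ), a ≠ 0 ∧ h = level a c

/-- A tour: a closed polyline, given by its (at least one) cyclically ordered corners
`pt 0, …, pt n`. Addition in `Fin (n + 1)` is modulo `n + 1`, so the corner following
`pt i` is `pt (i + 1)` and the corner following `pt n` is `pt 0`.
A single point is a (degenerate) tour. -/
structure Tour (d : ℕ) where
  /-- The number of corners minus one. -/
  n : ℕ
  /-- The corners. -/
  pt : Fin (n + 1) → E d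

/-- The set of points on a tour. -/
def Tour.carrier {d : ℕ} (T : Tour d) : Set (E d) :=
  ⋃ i, segment ℝ (T.pt i) (T.pt (i + 1))

/-- The Euclidean length `|T|` of a tour. -/
noncomputable def Tour.length {d : ℕ} (T : Tour d) : ℝ :=
  ∑ i, dist (T.pt i) (T.pt (i + 1))

/-- A tour is feasible for `I` if it visits every hyperplane of `I`. -/
def Tour.Feasible {d : ℕ} (T : Tour d) (I : Set (Set (E d))) : Prop :=
  ∀ h ∈ I, (T.carrier ∩ h).Nonempty

/-- `T` is an optimal tour for `I`: a feasible tour of minimum length. -/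
def IsOptimalTour {d : ℕ} (I : Set (Set (E d))) (T : Tour d) : Prop :=
  T.Feasible I ∧ ∀ S : Tour d, S.Feasible I → T.length ≤ S.length

/-- `T` is a shortest tour of the point set `A`, among all closed polylines that contain
every point of `A`. -/
def IsShortestTour {d : ℕ} (A : Set (E d)) (T : Tour d) : Prop :=
  A ⊆ T.carrier ∧ ∀ S : Tour d, A ⊆ S.carrier → T.length ≤ S.length

/-- The vertices of a polyhedron: its extreme points. -/
def vertices {d : ℕ} (P : Set (E d)) : Set (E d) := P.extremePoints ℝ

/-- The set `±H` of all closed half-spaces bordered by hyperplanes of `H`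
(two for each hyperplane of `H`). -/
def halfSpaces {d : ℕ} (H : Set (Set (E d))) : Set (Set (E d)) :=
  {s | ∃ (a : E d) (c : ℝ), a ≠ 0 ∧ level a c ∈ H ∧ s = lower a c}

/-- All bounded sets that arise by translating each half-space `s` of `±H` by some vector
`τ s` and intersecting the translates. -/
def polytopes {d : ℕ} (H : Set (Set (E d))) : Set (Set (E d)) :=
  {P | Bornology.IsBounded P ∧
    ∃ τ : Set (E d) → E d, P = ⋂ s ∈ halfSpaces H, (fun x => τ s + x) '' s}

/-- The number `k = (⌈2π / arctan(ε / √(d² - 1))⌉ √d) ^ (d - 1)` (equal to `1` if `d = 1`). -/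
noncomputable def kConst (ε : ℝ) (d : ℕ) : ℝ :=
  ((⌈2 * π / arctan (ε / √((d : ℝ) ^ 2 - 1))⌉₊ : ℝ) * √(d : ℝ)) ^ (d - 1)

/-- The side length `ε / (k √d (2ᵈ + 1))` of the cells of the grid. -/
noncomputable def granularity (ε : ℝ) (d : ℕ) : ℝ :=
  ε / (kConst ε d * √(d : ℝ) * (2 ^ d + 1))

/-- The grid points of the cartesian grid that is laid over the unit cube `[0,1]ᵈ`, with the
origin as a grid point. The grid covers the cube with as few cells as possible, so it has
`⌈1 / granularity⌉` cells in every coordinate direction. -/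
noncomputable def gridPoints (ε : ℝ) (d : ℕ) : Set (E d) :=
  {x | ∃ z : Fin d → ℕ,
    (∀ i, z i ≤ ⌈1 / granularity ε d⌉₊) ∧ ∀ i, x i = granularity ε d * z i}

/-- The base set of hyperplanes: all hyperplanes `h` that are uniquely defined by a `d`-tuple
of grid points, i.e. `h` is the only hyperplane that contains all points of the tuple. -/
noncomputable def baseSet (ε : ℝ) (d : ℕ) : Set (Set (E d)) :=
  {h | ∃ p : Fin d → E d, (∀ j, p j ∈ gridPoints ε d) ∧
    IsHyperplane h ∧ (∀ j, p j ∈ h) ∧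
    ∀ h' : Set (E d), IsHyperplane h' → (∀ j, p j ∈ h') → h' = h}

end HyperplaneTSPN

/-!
# Approximating an optimal tour of hyperplanes by a tour of a polytope's vertices

A tour is connected, so it meets a hyperplane as soon as its convex hull does. Hence every tour
through the vertices of a polytope `P` that contains an optimal tour `T` is feasible, and it
suffices to find such a `P` in `polytopes (baseSet ε d)` together with some tour through its
vertices of length at most `(1 + ε) |T|` (`exists_polytope_of_tour`).

Among the corners of `T` a small set `S` is selected whose hull, enlarged by a factor `1 + δ`
about some point, contains all of them. The tour `T` is enlarged by the same factor and put into a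
cube whose side is half its length, over which the grid is laid. Each point of the enlarged `S`
lies in a simplex of at most `d + 1` corners of a grid cell, and a detour of `d + 2` steps visits
these corners. The hull `P` of all these corners contains `T`, and the tour through them has length
at most `(1 + δ) (1 + |S| (d + 2) √d g / 2) |T|` with `g` the granularity
(`exists_rounded_polytope`).

Two facts remain.

* Hulls of sets of grid points, also lower-dimensional ones, belong to the polytopes of the base
  set: a point outside can be separated by a hyperplane with a normal that is determined by grid
  points (`exists_separating_level`). This follows by moving a separating functional until its
  tight constraints span as much as possible.
* `δ` and `|S|` can be chosen such that `(1 + δ) (1 + |S| (d + 2) √d g / 2) ≤ 1 + ε`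
  (`exists_cheap_approximation`). The set of corners is first brought into a position in which its
  width is `1` in each coordinate direction and is attained by a chord parallel to that direction
  (`exists_extremal_coordinates`, by maximizing a determinant). If its dimension `r` is at most
  `1`, two points suffice with `δ = 0`. In general, `2 r (n ^ (r - 1) + 1)` points give
  `δ = 2 r / n` (`exists_radial_approximation`), which is good enough in the space of dimension
  `d ≥ 3` for a suitable `n`. In the plane the chords cross, which allows for `8 n` points with
  `δ = 1 / (2 n)` (`exists_planar_approximation`).

The existence of optimal tours and of shortest tours rests on shortcutting: a tour may be replaced
by one whose corners are just the points that it has to visit (`Tour.exists_shortcut`).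
-/

namespace HyperplaneTSPN

open Real

/-! ### Polygonal paths as lists -/

section Chain

variable {X : Type*} [PseudoMetricSpace X]

/-- The length of the polygonal path from `x` to `z` through the points of the list, in
order. The closed polyline with corners `x :: l` has length `chainLength x l x`. -/
noncomputable def chainLength : X → List X → X → ℝ
  | x, [], z => dist x z
  | x, y :: l, z => dist x y + chainLength y l z

@[simp] lemma chainLength_nil (x z : X) : chainLength x [] z = dist x z := rfl

@[simp] lemma chainLength_cons (x y z : X) (l : List X) :
    chainLength x (y :: l) z = dist x y + chainLength y l z := rfl

lemma dist_le_chainLength (x z : X) (l : List X) : dist x z ≤ chainLength x l z := by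
  induction l generalizing x with
  | nil => simp
  | cons y l ih =>
    have := ih y
    have := dist_triangle x y z
    simp only [chainLength_cons]; linarith

lemma chainLength_append (x y z : X) (l l' : List X) :
    chainLength x (l ++ y :: l') z = chainLength x l y + chainLength y l' z := by
  induction l generalizing x with
  | nil => simp
  | cons a l ih => simp [ih, add_assoc]

lemma chainLength_le_start (w x z : X) (l : List X) :
    chainLength x l z ≤ dist x w + chainLength w l z := by
  cases l with
  | nil => simpa using dist_triangle x w z
  | cons y l =>
    have := dist_triangle x w y
    simp only [chainLength_cons]; linarith

lemma chainLength_le_end (w x z : X) (l : List X) :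
    chainLength x l z ≤ chainLength x l w + dist w z := by
  induction l generalizing x with
  | nil => simpa using dist_triangle x w z
  | cons y l ih =>
    have := ih y
    simp only [chainLength_cons]; linarith

/-- Shortcutting does not lengthen a path. -/
lemma chainLength_sublist {l l' : List X} (h : l.Sublist l') (x z : X) :
    chainLength x l z ≤ chainLength x l' z := by
  induction h generalizing x with
  | slnil => simp
  | @cons l l' a h ih =>
    have h1 := ih a
    have h2 := chainLength_le_start a x z l
    simp only [chainLength_cons]; linarith
  | @cons_cons l l' a h ih =>
    have := ih a
    simp only [chainLength_cons]; linarith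

lemma chainLength_replicate (x z : X) (l : List X) (j : ℕ) :
    chainLength x (List.replicate j x ++ l) z = chainLength x l z := by
  induction j with
  | zero => simp
  | succ j ih => simp [List.replicate_succ, ih]

lemma two_mul_dist_le_chainLength {l : List X} {p q : X} (hp : p ∈ l) (hq : q ∈ l) (x : X) :
    2 * dist p q ≤ chainLength x l x := by
  have key : ∀ p q : X, [p, q].Sublist l → 2 * dist p q ≤ chainLength x l x := by
    intro p q h
    have h1 := chainLength_sublist h x x
    have h2 := dist_triangle p x q
    simp only [chainLength_cons, chainLength_nil] at h1
    rw [dist_comm x p, dist_comm q x] at h1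
    linarith
  by_cases hpq : p = q
  · subst hpq
    simpa using dist_le_chainLength x x l
  obtain ⟨s, t, rfl⟩ := List.append_of_mem hp
  rcases List.mem_append.1 hq with h | h
  · rw [dist_comm]
    refine key q p ?_
    exact (List.singleton_sublist.2 h).append (List.singleton_sublist.2 (List.mem_cons_self))
  · have h' : q ∈ t := by
      rcases List.mem_cons.1 h with h | h
      · exact absurd h.symm hpq
      · exact h
    refine key p q ?_
    exact ((List.singleton_sublist.2 h').cons_cons p).trans (List.sublist_append_right _ _)

/-- A detour that leaves a visited point `q`, runs through the points of `v` and returns to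
`q` costs one step more than there are points in `v`. -/
lemma exists_insert_detour {l : List X} {q : X} (hq : q ∈ l) (v : List X) {R : ℝ}
    (hqv : ∀ p ∈ v, dist q p ≤ R) (hvv : ∀ p ∈ v, ∀ p' ∈ v, dist p p' ≤ R) (hR : 0 ≤ R)
    (x : X) : ∃ l' : List X, l ⊆ l' ∧ v ⊆ l' ∧
      chainLength x l' x ≤ chainLength x l x + (v.length + 1) * R := by
  obtain ⟨s, t, rfl⟩ := List.append_of_mem hq
  have key : ∀ (w : List X) (y : X), w ⊆ v → (∀ p ∈ w, dist y p ≤ R) → dist y q ≤ R →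
      chainLength y w q ≤ (w.length + 1) * R := by
    intro w
    induction w with
    | nil => intro y _ _ h; simpa using h
    | cons a w ih =>
      intro y hw hy _
      have hav : a ∈ v := hw (by simp)
      have h1 := ih a (fun p hp => hw (by simp [hp]))
        (fun p hp => hvv a hav p (hw (by simp [hp]))) (by rw [dist_comm]; exact hqv a hav)
      have h2 := hy a (by simp)
      simp only [chainLength_cons, List.length_cons]
      push_cast
      linarith
  refine ⟨s ++ q :: (v ++ q :: t), ?_, ?_, ?_⟩
  · intro p hp; simp only [List.mem_append, List.mem_cons] at hp ⊢; tauto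
  · intro p hp; simp [hp]
  · have := key v q (fun _ h => h) hqv (by simpa using hR)
    rw [chainLength_append, chainLength_append, chainLength_append]
    linarith

/-- Simultaneous detours at all points of a finite set. -/
lemma exists_insert_detours {ι : Type*} (J : Finset ι) (q : ι → X) (v : ι → List X) (x : X)
    {R : ℝ} (hR : 0 ≤ R) (D : ℕ) (hD : ∀ i ∈ J, (v i).length ≤ D)
    (hqv : ∀ i ∈ J, ∀ p ∈ v i, dist (q i) p ≤ R)
    (hvv : ∀ i ∈ J, ∀ p ∈ v i, ∀ p' ∈ v i, dist p p' ≤ R)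
    (l : List X) (hl : ∀ i ∈ J, q i ∈ l) :
    ∃ l' : List X, l ⊆ l' ∧ (∀ i ∈ J, v i ⊆ l') ∧
      chainLength x l' x ≤ chainLength x l x + J.card * ((D + 1) * R) := by
  classical
  induction J using Finset.induction_on with
  | empty => exact ⟨l, fun _ h => h, by simp, by simp⟩
  | insert i J hi ih =>
    obtain ⟨l₁, h1, h2, h3⟩ := ih (fun j hj => hD j (Finset.mem_insert_of_mem hj))
      (fun j hj => hqv j (Finset.mem_insert_of_mem hj))
      (fun j hj => hvv j (Finset.mem_insert_of_mem hj))
      (fun j hj => hl j (Finset.mem_insert_of_mem hj))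
    have hii := Finset.mem_insert_self i J
    obtain ⟨l₂, g1, g2, g3⟩ := exists_insert_detour (h1 (hl i hii)) (v i) (hqv i hii)
      (hvv i hii) hR x
    refine ⟨l₂, fun p hp => g1 (h1 hp), ?_, ?_⟩
    · intro j hj
      rcases Finset.mem_insert.1 hj with rfl | hj
      · exact g2
      · exact fun p hp => g1 (h2 j hj hp)
    · have : ((v i).length : ℝ) ≤ D := by exact_mod_cast hD i hii
      have h4 : ((v i).length + 1 : ℝ) * R ≤ (D + 1) * R := by gcongr
      rw [Finset.card_insert_of_notMem hi]
      push_cast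
      linarith

end Chain

section ChainSet

variable {F : Type*} [NormedAddCommGroup F] [NormedSpace ℝ F]

/-- The set of points on the polygonal path from `x` to `z` through the points of a list. -/
def chainSet : F → List F → F → Set F
  | x, [], z => segment ℝ x z
  | x, y :: l, z => segment ℝ x y ∪ chainSet y l z

/-- A point on a segment splits it into two that cover it. -/
lemma segment_subset_union_of_mem {x y a : F} (ha : a ∈ segment ℝ x y) :
    segment ℝ x y ⊆ segment ℝ x a ∪ segment ℝ a y := by
  rw [segment_eq_image_lineMap] at ha
  obtain ⟨s, hs, rfl⟩ := ha
  intro b hb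
  rw [segment_eq_image_lineMap] at hb
  obtain ⟨t, ht, rfl⟩ := hb
  rcases le_total t s with h | h
  · left
    have h1 : t ∈ segment ℝ (0 : ℝ) s := by
      rw [segment_eq_Icc (ht.1.trans h)]; exact ⟨ht.1, h⟩
    have h2 := mem_segment_iff_wbtw.1 h1
    have h3 := h2.map (AffineMap.lineMap x y : ℝ →ᵃ[ℝ] F)
    rw [AffineMap.lineMap_apply_zero] at h3
    exact mem_segment_iff_wbtw.2 h3
  · right
    have h1 : t ∈ segment ℝ s (1 : ℝ) := by
      rw [segment_eq_Icc (h.trans ht.2)]; exact ⟨h, ht.2⟩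
    have h2 := mem_segment_iff_wbtw.1 h1
    have h3 := h2.map (AffineMap.lineMap x y : ℝ →ᵃ[ℝ] F)
    rw [AffineMap.lineMap_apply_one] at h3
    exact mem_segment_iff_wbtw.2 h3

/-- A point on a path can be made one of its corners. -/
lemma exists_subdivide {a z : F} {l : List F} {x : F} (ha : a ∈ chainSet x l z) :
    ∃ l' : List F, l ⊆ l' ∧ a ∈ l' ∧ chainLength x l' z = chainLength x l z ∧
      chainSet x l z ⊆ chainSet x l' z := by
  induction l generalizing x with
  | nil =>
    refine ⟨[a], by simp, by simp, ?_, ?_⟩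
    · simpa using dist_add_dist_of_mem_segment ha
    · exact segment_subset_union_of_mem ha
  | cons y l ih =>
    rcases ha with ha | ha
    · refine ⟨a :: y :: l, by simp, by simp, ?_, ?_⟩
      · have := dist_add_dist_of_mem_segment ha
        simp only [chainLength_cons]; linarith
      · intro p hp
        rcases hp with hp | hp
        · rcases segment_subset_union_of_mem ha hp with h | h
          · exact Or.inl h
          · exact Or.inr (Or.inl h)
        · exact Or.inr (Or.inr hp)
    · obtain ⟨l', h1, h2, h3, h4⟩ := ih ha
      refine ⟨y :: l', List.cons_subset_cons y h1, by simp [h2], by simp [h3], ?_⟩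
      exact Set.union_subset_union_right _ h4

lemma exists_subdivide_finset {z : F} {l : List F} {x : F} (A : Finset F)
    (hA : (A : Set F) ⊆ chainSet x l z) :
    ∃ l' : List F, l ⊆ l' ∧ (∀ a ∈ A, a ∈ l') ∧ chainLength x l' z = chainLength x l z ∧
      chainSet x l z ⊆ chainSet x l' z := by
  classical
  induction A using Finset.induction_on with
  | empty => exact ⟨l, by simp, by simp, rfl, subset_rfl⟩
  | insert a A _ ih =>
    obtain ⟨l₁, h1, h2, h3, h4⟩ := ih (fun p hp => hA (by simpa using Or.inr hp))
    obtain ⟨l₂, g1, g2, g3, g4⟩ := exists_subdivide (h4 (hA (by simp : a ∈ _)))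
    refine ⟨l₂, fun p hp => g1 (h1 hp), ?_, g3.trans h3, h4.trans g4⟩
    intro p hp
    rcases Finset.mem_insert.1 hp with rfl | hp
    · exact g2
    · exact g1 (h2 p hp)

end ChainSet

/-! ### Tours and lists of corners -/

lemma chainLength_ofFn {X : Type*} [PseudoMetricSpace X] (n : ℕ) (f : Fin (n + 1) → X) (z : X) :
    chainLength (f 0) (List.ofFn fun i : Fin n => f i.succ) z =
      ∑ i : Fin n, dist (f i.castSucc) (f i.succ) + dist (f (Fin.last n)) z := by
  induction n with
  | zero => simp
  | succ n ih =>
    have := ih (fun i => f i.succ)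
    rw [List.ofFn_succ, chainLength_cons, Fin.sum_univ_succ]
    refine (congrArg _ this).trans ?_
    rw [← add_assoc (dist _ _)]
    rfl

lemma Tour.length_eq_chainLength {d : ℕ} (T : Tour d) :
    T.length = chainLength (T.pt 0) (List.ofFn fun i : Fin T.n => T.pt i.succ) (T.pt 0) := by
  rw [chainLength_ofFn, Tour.length, Fin.sum_univ_castSucc]
  simp

lemma chainSet_ofFn {F : Type*} [NormedAddCommGroup F] [NormedSpace ℝ F]
    (n : ℕ) (f : Fin (n + 1) → F) (z : F) :
    chainSet (f 0) (List.ofFn fun i : Fin n => f i.succ) z =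
      (⋃ i : Fin n, segment ℝ (f i.castSucc) (f i.succ)) ∪ segment ℝ (f (Fin.last n)) z := by
  induction n with
  | zero => simp [chainSet]
  | succ n ih =>
    have := ih (fun i => f i.succ)
    rw [List.ofFn_succ, chainSet, this]
    ext p
    simp only [Set.mem_union, Set.mem_iUnion, Fin.exists_fin_succ]
    simp only [Fin.castSucc_zero, or_assoc, Fin.succ_castSucc, Fin.succ_last]

lemma Tour.carrier_eq_chainSet {d : ℕ} (T : Tour d) :
    T.carrier = chainSet (T.pt 0) (List.ofFn fun i : Fin T.n => T.pt i.succ) (T.pt 0) := by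
  rw [chainSet_ofFn, Tour.carrier]
  ext p
  simp only [Set.mem_union, Set.mem_iUnion, Fin.exists_fin_succ']
  simp

lemma Tour.pt_mem_carrier {d : ℕ} (T : Tour d) (i : Fin (T.n + 1)) : T.pt i ∈ T.carrier :=
  Set.mem_iUnion.2 ⟨i, left_mem_segment ℝ _ _⟩

/-- The closed polyline with corners `x :: l`, with a prescribed number of corners. -/
lemma exists_pt_of_chain {d : ℕ} (x : E d) (l : List (E d)) (n : ℕ) (hn : l.length = n) :
    ∃ pt : Fin (n + 1) → E d, Set.range pt = {p | p ∈ x :: l} ∧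
      (Tour.mk n pt).length = chainLength x l x := by
  subst hn
  refine ⟨fun i => (x :: l).get i, ?_, ?_⟩
  · exact Set.range_list_get (x :: l)
  · rw [Tour.length_eq_chainLength]
    congr 1
    simp

lemma Tour.length_nonneg {d : ℕ} (T : Tour d) : 0 ≤ T.length :=
  Finset.sum_nonneg fun _ _ => dist_nonneg

/-- Any finite set of points on a tour can be visited by a tour that has just these points as
corners and is not longer. -/
lemma Tour.exists_shortcut {d : ℕ} (T : Tour d) (A : Finset (E d)) (hA : A.Nonempty)
    (hAT : (A : Set (E d)) ⊆ T.carrier) (K : ℕ) (hK : A.card ≤ K + 1) :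
    ∃ pt : Fin (K + 1) → E d, Set.range pt = A ∧ (Tour.mk K pt).length ≤ T.length := by
  classical
  rw [T.carrier_eq_chainSet] at hAT
  obtain ⟨l, -, h2, h3, -⟩ := exists_subdivide_finset A hAT
  rw [← T.length_eq_chainLength] at h3
  set x := T.pt 0
  set q := (l.filter (· ∈ A)).dedup with hq
  have hql : q.Sublist l := (List.dedup_sublist _).trans (List.filter_sublist)
  have hmem : ∀ p, p ∈ q ↔ p ∈ A := by
    intro p
    simp only [hq, List.mem_dedup, List.mem_filter, decide_eq_true_eq]
    exact ⟨fun h => h.2, fun h => ⟨h2 p h, h⟩⟩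
  have hcard : q.length = A.card := by
    rw [← List.toFinset_card_of_nodup (List.nodup_dedup _)]
    congr 1
    ext p; rw [List.mem_toFinset, hmem]
  cases hq' : q with
  | nil =>
    obtain ⟨p, hp⟩ := hA
    rw [← hmem, hq'] at hp
    simp at hp
  | cons y q' =>
    rw [hq'] at hcard hmem hql
    simp only [List.length_cons] at hcard
    obtain ⟨pt, h4, h5⟩ := exists_pt_of_chain y (List.replicate (K - q'.length) y ++ q') K
      (by simp; omega)
    refine ⟨pt, ?_, ?_⟩
    · rw [h4]
      ext p
      rw [Finset.mem_coe, ← hmem]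
      simp only [List.mem_cons, List.mem_append, List.mem_replicate, Set.mem_ofPred_eq]
      tauto
    · rw [h5, chainLength_replicate]
      have h6 := chainLength_sublist hql x x
      have h7 := chainLength_le_end x y y q'
      rw [chainLength_cons] at h6
      linarith

/-- A tour has to go from `p` to `q` and back. -/
lemma Tour.two_mul_dist_le_length {d : ℕ} (T : Tour d) {p q : E d} (hp : p ∈ T.carrier)
    (hq : q ∈ T.carrier) : 2 * dist p q ≤ T.length := by
  classical
  rw [T.carrier_eq_chainSet] at hp hq
  obtain ⟨l, -, h2, h3, -⟩ := exists_subdivide_finset {p, q}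
    (by intro a ha; simp at ha; rcases ha with rfl | rfl <;> assumption)
  rw [T.length_eq_chainLength, ← h3]
  exact two_mul_dist_le_chainLength (h2 p (by simp)) (h2 q (by simp)) _

lemma Tour.isPreconnected_carrier {d : ℕ} (T : Tour d) : IsPreconnected T.carrier := by
  refine IsPreconnected.iUnion_of_chain (fun i => (convex_segment _ _).isPreconnected) ?_
  intro i
  by_cases hi : i = Fin.last T.n
  · subst hi
    rw [show Order.succ (Fin.last T.n) = Fin.last T.n from Order.succ_eq_iff_isMax.2 (fun a _ => Fin.le_last a)]
    exact ⟨_, left_mem_segment ℝ _ _, left_mem_segment ℝ _ _⟩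
  · have : Order.succ i = i + 1 := by
      rw [Fin.orderSucc_eq]
      obtain ⟨j, rfl⟩ := Fin.exists_castSucc_eq.2 hi
      simp
    rw [this]
    exact ⟨_, right_mem_segment ℝ _ _, left_mem_segment ℝ _ _⟩

lemma Tour.carrier_subset_convexHull {d : ℕ} (T : Tour d) :
    T.carrier ⊆ convexHull ℝ (Set.range T.pt) := by
  refine Set.iUnion_subset fun i => (convex_convexHull ℝ _).segment_subset ?_ ?_ <;>
  exact subset_convexHull ℝ _ ⟨_, rfl⟩

/-! ### Existence of shortest and of optimal tours -/

/-- A finite point set has a shortest tour: by shortcutting, only the finitely many tours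
with corners in the set compete. -/
lemma exists_isShortestTour {d : ℕ} (A : Finset (E d)) :
    ∃ T : Tour d, IsShortestTour (A : Set (E d)) T := by
  classical
  rcases A.eq_empty_or_nonempty with rfl | hA
  · refine ⟨⟨0, fun _ => 0⟩, by simp, fun S _ => ?_⟩
    have : (Tour.mk 0 fun _ => (0 : E d)).length = 0 := by simp [Tour.length]
    rw [this]; exact S.length_nonneg
  obtain ⟨K, hK⟩ : ∃ K, A.card = K + 1 := ⟨A.card - 1, by have := hA.card_pos; omega⟩
  let F := {f : Fin (K + 1) → A // Function.Surjective f}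
  have hne : Nonempty F := ⟨⟨(A.equivFinOfCardEq hK).symm, Equiv.surjective _⟩⟩
  obtain ⟨f, hf⟩ := Finite.exists_min
    (fun f : F => (Tour.mk K fun i => (f.1 i : E d)).length)
  refine ⟨⟨K, fun i => (f.1 i : E d)⟩, ?_, ?_⟩
  · intro a ha
    obtain ⟨i, hi⟩ := f.2 ⟨a, ha⟩
    have := Tour.pt_mem_carrier ⟨K, fun i => (f.1 i : E d)⟩ i
    dsimp only at this
    rwa [hi] at this
  · intro S hS
    obtain ⟨pt, h1, h2⟩ := S.exists_shortcut A hA hS K hK.le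
    have hpt : ∀ i, pt i ∈ A := fun i => by
      rw [← Finset.mem_coe, ← h1]; exact ⟨i, rfl⟩
    refine le_trans (hf ⟨fun i => ⟨pt i, hpt i⟩, ?_⟩) h2
    rintro ⟨a, ha⟩
    rw [← Finset.mem_coe, ← h1] at ha
    obtain ⟨i, hi⟩ := ha
    exact ⟨i, Subtype.ext hi⟩

lemma isClosed_level {d : ℕ} (a : E d) (c : ℝ) : IsClosed (level a c) :=
  isClosed_eq (by fun_prop) (by fun_prop)

lemma level_nonempty {d : ℕ} {a : E d} (ha : a ≠ 0) (c : ℝ) : (level a c).Nonempty := by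
  refine ⟨(c / ‖a‖ ^ 2) • a, ?_⟩
  have : ‖a‖ ≠ 0 := norm_ne_zero_iff.2 ha
  simp only [level, Set.mem_ofPred_eq, inner_smul_right, real_inner_self_eq_norm_sq]
  field_simp

lemma continuous_length {d : ℕ} (K : ℕ) :
    Continuous fun pt : Fin (K + 1) → E d => (Tour.mk K pt).length := by
  change Continuous fun pt : Fin (K + 1) → E d => ∑ i : Fin (K + 1), dist (pt i) (pt (i + 1))
  refine continuous_finsetSum _ fun i _ => ?_
  fun_prop

/-- Within a subspace, a point is bounded in terms of its inner products with the vectors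
that span the subspace. -/
lemma exists_norm_le_of_inner_le {F : Type*} [NormedAddCommGroup F] [InnerProductSpace ℝ F]
    {ι : Type*} [Finite ι] [FiniteDimensional ℝ F] (a : ι → F) (B : ℝ) :
    ∃ R, ∀ y ∈ Submodule.span ℝ (Set.range a), (∀ i, |inner ℝ (a i) y| ≤ B) → ‖y‖ ≤ R := by
  have := Fintype.ofFinite ι
  let S := Submodule.span ℝ (Set.range a)
  let f : S →ₗ[ℝ] (ι → ℝ) := LinearMap.pi fun i => (innerₛₗ ℝ (a i)).comp S.subtype
  have hf : LinearMap.ker f = ⊥ := by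
    rw [LinearMap.ker_eq_bot']
    rintro ⟨y, hy⟩ h
    have h1 : ∀ i, inner ℝ (a i) y = 0 := fun i => congrFun h i
    have h2 : S ≤ (ℝ ∙ y)ᗮ := by
      refine Submodule.span_le.2 ?_
      rintro _ ⟨i, rfl⟩
      refine Submodule.mem_orthogonal_singleton_iff_inner_left.2 (h1 i)
    have h3 := Submodule.mem_orthogonal_singleton_iff_inner_left.1 (h2 hy)
    exact Subtype.ext (by simpa using h3)
  obtain ⟨K, -, hK⟩ := f.exists_antilipschitzWith hf
  refine ⟨K * |B|, fun y hy h => ?_⟩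
  have h1 := hK.le_mul_dist ⟨y, hy⟩ 0
  rw [map_zero, dist_zero_right, dist_zero_right] at h1
  refine h1.trans ?_
  gcongr
  rw [pi_norm_le_iff_of_nonneg (abs_nonneg B)]
  exact fun i => (h i).trans (le_abs_self B)

/-- An optimal tour exists for every finite set of hyperplanes. Shortcutting bounds the number of
corners, and translating orthogonally to all normals makes the set of competitors compact. -/
lemma exists_isOptimalTour {d : ℕ} (I : Set (Set (E d))) (hfin : I.Finite)
    (hI : ∀ h ∈ I, IsHyperplane h) : ∃ T : Tour d, IsOptimalTour I T := by
  classical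
  rcases I.eq_empty_or_nonempty with rfl | hIne
  · refine ⟨⟨0, fun _ => 0⟩, by simp [Tour.Feasible], fun S _ => ?_⟩
    have : (Tour.mk 0 fun _ => (0 : E d)).length = 0 := by simp [Tour.length]
    rw [this]; exact S.length_nonneg
  have := hfin.to_subtype
  have := Fintype.ofFinite I
  have : Nonempty I := hIne.to_subtype
  choose a c ha hac using fun h : I => hI h h.2
  obtain ⟨K, hK⟩ : ∃ K, Fintype.card I = K + 1 :=
    ⟨Fintype.card I - 1, by have := Fintype.card_pos (α := I); omega⟩
  let len : (Fin (K + 1) → E d) → ℝ := fun pt => (Tour.mk K pt).length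
  let Z : Set (Fin (K + 1) → E d) := {pt | ∀ h : I, ∃ j, pt j ∈ level (a h) (c h)}
  let S := Submodule.span ℝ (Set.range a)
  have hZfeas : ∀ pt ∈ Z, (Tour.mk K pt).Feasible I := by
    intro pt hpt h hh
    obtain ⟨j, hj⟩ := hpt ⟨h, hh⟩
    exact ⟨pt j, Tour.pt_mem_carrier ⟨K, pt⟩ j, by rw [show h = _ from hac ⟨h, hh⟩]; exact hj⟩
  have hreduce : ∀ T : Tour d, T.Feasible I → ∃ pt ∈ Z, len pt ≤ T.length := by
    intro T hT
    choose x hx using fun h : I => hT h h.2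
    obtain ⟨pt, h1, h2⟩ := T.exists_shortcut (Finset.univ.image x)
      (Finset.univ_nonempty.image x) (by
        intro p hp
        obtain ⟨h, -, rfl⟩ := Finset.mem_image.1 hp
        exact (hx h).1) K (Finset.card_image_le.trans (by rw [Finset.card_univ, hK]))
    refine ⟨pt, fun h => ?_, h2⟩
    have : x h ∈ Set.range pt := by rw [h1]; simp
    obtain ⟨j, hj⟩ := this
    refine ⟨j, ?_⟩
    rw [hj, ← hac h]
    exact (hx h).2
  have htrans : ∀ pt ∈ Z, ∃ pt' ∈ Z, pt' 0 ∈ S ∧ len pt' = len pt := by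
    intro pt hpt
    let v : E d := pt 0 - S.starProjection (pt 0)
    have hv : ∀ h, inner ℝ (a h) v = 0 := fun h =>
      (Submodule.sub_starProjection_mem_orthogonal (K := S) (pt 0)) _
        (Submodule.subset_span ⟨h, rfl⟩)
    refine ⟨fun j => pt j - v, fun h => ?_, ?_, ?_⟩
    · obtain ⟨j, hj⟩ := hpt h
      refine ⟨j, ?_⟩
      simp only [level, Set.mem_ofPred_eq, inner_sub_right, hv, sub_zero] at hj ⊢
      exact hj
    · simp [v]
    · simp [len, Tour.length]
  obtain ⟨z, hz⟩ : Z.Nonempty := by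
    choose x hx using fun h => level_nonempty (ha h) (c h)
    let e := Fintype.equivFinOfCardEq hK
    exact ⟨fun j => x (e.symm j), fun h => ⟨e h, by simpa using hx h⟩⟩
  obtain ⟨z, hz, hzS, -⟩ := htrans z hz
  let B : Set (Fin (K + 1) → E d) := {pt | pt ∈ Z ∧ pt 0 ∈ S ∧ len pt ≤ len z}
  have hBc : IsCompact B := by
    refine Metric.isCompact_of_isClosed_isBounded ?_ ?_
    · refine IsClosed.inter ?_ (IsClosed.inter ?_ ?_)
      · have : Z = ⋂ h : I, ⋃ j, {pt | pt j ∈ level (a h) (c h)} := by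
          ext pt; simp [Z]
        rw [this]
        exact isClosed_iInter fun h => isClosed_iUnion_of_finite fun j =>
          (isClosed_level _ _).preimage (continuous_apply j)
      · exact S.closed_of_finiteDimensional.preimage (continuous_apply 0)
      · exact isClosed_le (continuous_length K) continuous_const
    · obtain ⟨M, hM⟩ := (Set.finite_range fun h : I => |c h| + ‖a h‖ * len z).bddAbove
      obtain ⟨R, hR⟩ := exists_norm_le_of_inner_le a M
      have hlen : ∀ pt ∈ B, ∀ j, dist (pt j) (pt 0) ≤ len z := by
        intro pt hpt j
        have h1 := Tour.two_mul_dist_le_length ⟨K, pt⟩ (Tour.pt_mem_carrier ⟨K, pt⟩ j)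
          (Tour.pt_mem_carrier ⟨K, pt⟩ 0)
        have h2 : len pt ≤ len z := hpt.2.2
        have h3 : (0 : ℝ) ≤ dist (pt j) (pt 0) := dist_nonneg
        simp only [len] at h2 ⊢
        linarith
      rw [isBounded_iff_forall_norm_le]
      refine ⟨R + len z, fun pt hpt => ?_⟩
      have h0 : ‖pt 0‖ ≤ R := by
        refine hR _ hpt.2.1 fun h => ?_
        obtain ⟨j, hj⟩ := hpt.1 h
        refine le_trans ?_ (hM ⟨h, rfl⟩)
        have h1 : inner ℝ (a h) (pt 0) = c h - inner ℝ (a h) (pt j - pt 0) := by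
          rw [inner_sub_right, show inner ℝ (a h) (pt j) = c h from hj]; ring
        rw [h1]
        refine (abs_sub _ _).trans (add_le_add_right ?_ _)
        refine (abs_real_inner_le_norm _ _).trans
          (mul_le_mul_of_nonneg_left ?_ (norm_nonneg _))
        rw [← dist_eq_norm]
        exact hlen pt hpt j
      refine (pi_norm_le_iff_of_nonneg ?_).2 fun j => ?_
      · have := norm_nonneg (pt 0)
        have : 0 ≤ len z := Tour.length_nonneg _
        linarith
      · have h1 := hlen pt hpt j
        rw [dist_eq_norm] at h1
        have h2 := norm_le_norm_add_norm_sub' (pt j) (pt 0)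
        linarith
  obtain ⟨m, hm, hmin⟩ := hBc.exists_isMinOn ⟨z, hz, hzS, le_rfl⟩ (continuous_length K).continuousOn
  refine ⟨⟨K, m⟩, hZfeas m hm.1, fun T hT => ?_⟩
  obtain ⟨pt, hpt, h1⟩ := hreduce T hT
  obtain ⟨pt', h2, h3, h4⟩ := htrans pt hpt
  rcases le_total (len pt') (len z) with h | h
  · have : len m ≤ len pt' := hmin ⟨h2, h3, h⟩
    exact this.trans (h4.le.trans h1)
  · exact hm.2.2.trans (h.trans (h4.le.trans h1))

/-! ### Hulls of grid points are polytopes of the base set -/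

/-- A system of inequalities `1 ≤ ⟪a, u⟫` that has a solution has one at which the tight
constraints span everything: while they do not, move `a` orthogonally to them until a further
constraint becomes tight. -/
lemma exists_tight_span {F : Type*} [NormedAddCommGroup F] [InnerProductSpace ℝ F]
    [FiniteDimensional ℝ F] (U : Finset F) (h : ∃ a : F, ∀ u ∈ U, 1 ≤ inner ℝ a u) :
    ∃ a : F, (∀ u ∈ U, 1 ≤ inner ℝ a u) ∧
      (U : Set F) ⊆ Submodule.span ℝ {u | u ∈ U ∧ inner ℝ a u = 1} := by
  classical
  let rk : F → ℕ := fun a => Module.finrank ℝ (Submodule.span ℝ {u | u ∈ U ∧ inner ℝ a u = 1})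
  obtain ⟨n, ⟨a, ha, hn⟩, hmax⟩ : ∃ n, (∃ a, (∀ u ∈ U, 1 ≤ inner ℝ a u) ∧ rk a = n) ∧
      ∀ m, (∃ a, (∀ u ∈ U, 1 ≤ inner ℝ a u) ∧ rk a = m) → m ≤ n := by
    have hb : ∃ b : ℕ, ∀ m, (∃ a, (∀ u ∈ U, 1 ≤ inner ℝ a u) ∧ rk a = m) → m ≤ b := by
      refine ⟨Module.finrank ℝ F, ?_⟩
      rintro m ⟨a, -, rfl⟩
      exact Submodule.finrank_le _
    obtain ⟨a, ha⟩ := h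
    have hne : ∃ m, ∃ a, (∀ u ∈ U, 1 ≤ inner ℝ a u) ∧ rk a = m := ⟨rk a, a, ha, rfl⟩
    obtain ⟨b, hb⟩ := hb
    exact ⟨_, Nat.findGreatest_spec (P := fun m => ∃ a, (∀ u ∈ U, 1 ≤ inner ℝ a u) ∧ rk a = m)
      (hb _ hne.choose_spec) hne.choose_spec, fun m hm => Nat.le_findGreatest (hb m hm) hm⟩
  refine ⟨a, ha, ?_⟩
  set S := Submodule.span ℝ {u | u ∈ U ∧ inner ℝ a u = 1} with hS
  by_contra hcon
  obtain ⟨u₀, hu₀, hu₀S⟩ := Set.not_subset.1 hcon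
  let b : F := -(u₀ - S.starProjection u₀)
  have hbS : ∀ u ∈ S, inner ℝ b u = 0 := fun u hu => by
    rw [inner_neg_left, real_inner_comm,
      (Submodule.sub_starProjection_mem_orthogonal (K := S) u₀) u hu, neg_zero]
  have hbu : inner ℝ b u₀ < 0 := by
    have h1 : inner ℝ b u₀ = inner ℝ b (-b) := by
      have : u₀ = S.starProjection u₀ + -b := by simp [b]
      conv_lhs => rw [this]
      rw [inner_add_right, hbS _ (Submodule.starProjection_apply_mem _ _), zero_add]
    rw [h1, inner_neg_right, neg_lt_zero, real_inner_self_pos]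
    intro hb0
    apply hu₀S
    have h2 : u₀ = S.starProjection u₀ := by
      rw [← sub_eq_zero, ← neg_eq_zero]; exact hb0
    rw [h2]; exact Submodule.starProjection_apply_mem _ _
  obtain ⟨u₁, hu₁, hmin⟩ := (U.filter fun u => inner ℝ b u < 0).exists_min_image
    (fun u => (inner ℝ a u - 1) / (-inner ℝ b u)) ⟨u₀, by simpa using ⟨hu₀, hbu⟩⟩
  rw [Finset.mem_filter] at hu₁
  set t := (inner ℝ a u₁ - 1) / (-inner ℝ b u₁) with ht
  have ht0 : 0 ≤ t := div_nonneg (by linarith [ha u₁ hu₁.1]) (by linarith)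
  have hin : ∀ u, inner ℝ (a + t • b) u = inner ℝ a u + t * inner ℝ b u := fun u => by
    rw [inner_add_left, real_inner_smul_left]
  have ha' : ∀ u ∈ U, 1 ≤ inner ℝ (a + t • b) u := by
    intro u hu
    rw [hin]
    rcases lt_or_ge (inner ℝ b u) 0 with hneg | hpos
    · have h1 := hmin u (by simpa using ⟨hu, hneg⟩)
      rw [le_div_iff₀ (by linarith)] at h1
      linarith
    · have := ha u hu
      have := mul_nonneg ht0 hpos
      linarith
  have htight : inner ℝ (a + t • b) u₁ = 1 := by
    rw [hin, ht]
    have : inner ℝ b u₁ ≠ 0 := hu₁.2.ne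
    field_simp
    ring
  have hlt : S < Submodule.span ℝ {u | u ∈ U ∧ inner ℝ (a + t • b) u = 1} := by
    refine lt_of_le_of_ne (Submodule.span_mono ?_) ?_
    · rintro u ⟨hu, hu1⟩
      refine ⟨hu, ?_⟩
      rw [hin, hbS u (Submodule.subset_span ⟨hu, hu1⟩), hu1, mul_zero, add_zero]
    · intro heq
      have : u₁ ∈ S := by rw [heq]; exact Submodule.subset_span ⟨hu₁.1, htight⟩
      exact hu₁.2.ne (hbS _ this)
  have h1 := Submodule.finrank_lt_finrank_of_lt hlt
  have h2 := hmax _ ⟨a + t • b, ha', rfl⟩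
  rw [← hn] at h2
  exact absurd h1 (not_lt.2 h2)

lemma exists_forall_inner_basis_eq_one {F : Type*} [NormedAddCommGroup F]
    [InnerProductSpace ℝ F] [FiniteDimensional ℝ F] {ι : Type*} (b : Module.Basis ι ℝ F) :
    ∃ a : F, ∀ i, inner ℝ a (b i) = 1 := by
  let f : F →ₗ[ℝ] ℝ := b.constr ℝ fun _ => (1 : ℝ)
  refine ⟨(InnerProductSpace.toDual ℝ F).symm (LinearMap.toContinuousLinearMap f), fun i => ?_⟩
  rw [InnerProductSpace.toDual_symm_apply]
  simp [f]

/-- A point outside the hull of a finite subset `V` of `G` is separated from it by a hyperplane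
parallel to one that is determined by points of `G`. The hull need not be full-dimensional: the
tight points of `V` are completed by further points of `G`. -/
lemma exists_separating_level {d : ℕ} (hd : 1 ≤ d) (G : Set (E d))
    (hG : ∀ x, Submodule.span ℝ ((fun g => x - g) '' G) = ⊤) (V : Finset (E d))
    (hV : (V : Set (E d)) ⊆ G) {x : E d} (hx : x ∉ convexHull ℝ (V : Set (E d))) :
    ∃ (a : E d) (c : ℝ), a ≠ 0 ∧
      (∃ p : Fin d → E d, (∀ j, p j ∈ G) ∧ (∀ j, p j ∈ level a c) ∧
        ∀ h' : Set (E d), IsHyperplane h' → (∀ j, p j ∈ h') → h' = level a c) ∧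
      ∀ v ∈ V, inner ℝ a v < inner ℝ a x := by
  classical
  let U : Finset (E d) := V.image fun v => x - v
  have hsol : ∃ a : E d, ∀ u ∈ U, 1 ≤ inner ℝ a u := by
    obtain ⟨f, u, hfu, hux⟩ := geometric_hahn_banach_closed_point (convex_convexHull ℝ _)
      (V.finite_toSet.isClosed_convexHull ℝ) hx
    have hpos : ∀ v ∈ V, f v < f x ∧ f x - u ≤ f x - f v := fun v hv => by
      have := hfu v (subset_convexHull ℝ _ hv)
      exact ⟨by linarith, by linarith⟩
    refine ⟨(f x - u)⁻¹ • (InnerProductSpace.toDual ℝ (E d)).symm f, fun w hw => ?_⟩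
    obtain ⟨v, hv, rfl⟩ := Finset.mem_image.1 hw
    rw [real_inner_smul_left, InnerProductSpace.toDual_symm_apply, map_sub,
      ← div_eq_inv_mul, le_div_iff₀ (by linarith)]
    linarith [(hpos v hv).2]
  obtain ⟨a, ha, hspan⟩ := exists_tight_span U hsol
  obtain ⟨s, hs, hss, hsi⟩ := exists_linearIndependent ℝ {u | u ∈ U ∧ inner ℝ a u = 1}
  have hst : s ⊆ (fun g => x - g) '' G := by
    intro u hu
    obtain ⟨v, hv, rfl⟩ := Finset.mem_image.1 (hs hu).1
    exact ⟨v, hV hv, rfl⟩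
  obtain ⟨b, hbt, hsb, htb, hbi⟩ := exists_linearIndepOn_id_extension hsi hst
  let B : Module.Basis b ℝ (E d) := Module.Basis.mk hbi (by
    rw [← hG x]
    simp only [id_eq, Subtype.range_coe_subtype, Set.ofPred_mem_eq]
    exact Submodule.span_le.2 htb)
  have hBb : ∀ i : b, B i = i := fun i => by simp [B]
  obtain ⟨a', ha'⟩ := exists_forall_inner_basis_eq_one B
  have : Finite b := Module.Finite.finite_basis B
  have hcard : Nat.card b = d := by
    rw [← Module.finrank_eq_nat_card_basis B]; simp
  let e : Fin d ≃ b := (Finite.equivFinOfCardEq hcard).symm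
  choose g hg hgx using fun i : b => hbt i.2
  have hBg : ∀ i : b, B i = x - g i := fun i => by rw [hBb]; exact (hgx i).symm
  have hag : ∀ i : b, inner ℝ a' (g i) = inner ℝ a' x - 1 := fun i => by
    have := ha' i
    rw [hBg, inner_sub_right] at this
    linarith
  have ha'0 : a' ≠ 0 := by
    rintro rfl
    have := ha' (e ⟨0, hd⟩)
    simp at this
  refine ⟨a', inner ℝ a' x - 1, ha'0, ⟨fun j => g (e j), fun j => hg _, fun j => hag _, ?_⟩, ?_⟩
  · rintro h' ⟨a₂, c₂, ha₂, rfl⟩ hp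
    have h1 : ∀ i : b, inner ℝ a₂ (g i) = c₂ := fun i => by
      have := hp (e.symm i)
      simpa [level] using this
    have h2 : a₂ = (inner ℝ a₂ x - c₂) • a' := by
      refine InnerProductSpace.ext_inner_right_basis B fun i => ?_
      rw [real_inner_smul_left, ha', hBg, inner_sub_right, h1, mul_one]
    set κ := inner ℝ a₂ x - c₂ with hκ
    have hκ0 : κ ≠ 0 := by
      intro h0
      rw [h0, zero_smul] at h2
      exact ha₂ h2
    have h3 : c₂ = κ * (inner ℝ a' x - 1) := by
      have h4 : inner ℝ a₂ x = κ * inner ℝ a' x := by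
        conv_lhs => rw [h2, real_inner_smul_left]
      linarith
    ext y
    simp only [level, Set.mem_ofPred_eq]
    rw [h3]
    conv_lhs => rw [h2, real_inner_smul_left]
    exact mul_right_inj' hκ0
  · intro v hv
    have hmem : x - v ∈ Submodule.span ℝ s := by
      rw [hss]; exact hspan (Finset.mem_coe.2 (Finset.mem_image_of_mem _ hv))
    have heq : ∀ w ∈ Submodule.span ℝ s, inner ℝ a' w = inner ℝ a w := by
      intro w hw
      induction hw using Submodule.span_induction with
      | mem w hw =>
        rw [(hs hw).2]
        have := ha' ⟨w, hsb hw⟩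
        rwa [hBb] at this
      | zero => simp
      | add _ _ _ _ h1 h2 => rw [inner_add_right, inner_add_right, h1, h2]
      | smul r _ _ h1 => rw [real_inner_smul_right, real_inner_smul_right, h1]
    have h1 := ha _ (Finset.mem_image_of_mem _ hv : x - v ∈ U)
    rw [← heq _ hmem, inner_sub_right] at h1
    linarith

lemma image_add_lower {d : ℕ} (a : E d) (c : ℝ) (τ : E d) :
    (fun x => τ + x) '' lower a c = lower a (c + inner ℝ a τ) := by
  ext y
  simp only [lower, Set.mem_image, Set.mem_ofPred_eq]
  constructor
  · rintro ⟨x, hx, rfl⟩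
    rw [inner_add_right]; linarith
  · intro hy
    exact ⟨y - τ, by rw [inner_sub_right]; linarith, by abel⟩

/-- The hull of a finite set is a polytope of `H` if its outside points can be separated by
hyperplanes parallel to those of `H`. Each half-space is translated to its supporting position,
characterized as the smallest translate that contains the hull. -/
lemma convexHull_mem_polytopes {d : ℕ} (H : Set (Set (E d))) (V : Finset (E d))
    (hV : V.Nonempty)
    (hsep : ∀ x ∉ convexHull ℝ (V : Set (E d)), ∃ (a : E d) (c : ℝ), a ≠ 0 ∧ level a c ∈ H ∧
      ∀ v ∈ V, inner ℝ a v < inner ℝ a x) :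
    convexHull ℝ (V : Set (E d)) ∈ polytopes H := by
  set Q := convexHull ℝ (V : Set (E d)) with hQ
  have hmax : ∀ a : E d, ∃ v ∈ V, ∀ y ∈ Q, inner ℝ a y ≤ inner ℝ a v := by
    intro a
    obtain ⟨v, hv, hvm⟩ := V.exists_max_image (fun v => inner ℝ a v) hV
    refine ⟨v, hv, fun y hy => ?_⟩
    have hc : Convex ℝ {y : E d | inner ℝ a y ≤ inner ℝ a v} :=
      convex_halfSpace_le (innerₛₗ ℝ a).isLinear _
    exact convexHull_min (fun w hw => hvm w hw) hc hy
  have hτ : ∀ s : Set (E d), ∃ τ : E d, s ∈ halfSpaces H →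
      Q ⊆ (fun x => τ + x) '' s ∧ ∀ τ' : E d, Q ⊆ (fun x => τ' + x) '' s →
        (fun x => τ + x) '' s ⊆ (fun x => τ' + x) '' s := by
    intro s
    by_cases hs : s ∈ halfSpaces H
    · obtain ⟨a, c, ha, -, rfl⟩ := hs
      obtain ⟨v, hv, hvm⟩ := hmax a
      refine ⟨((inner ℝ a v - c) / ‖a‖ ^ 2) • a, fun _ => ?_⟩
      have : c + inner ℝ a (((inner ℝ a v - c) / ‖a‖ ^ 2) • a) = inner ℝ a v := by
        have : ‖a‖ ≠ 0 := norm_ne_zero_iff.2 ha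
        rw [real_inner_smul_right, real_inner_self_eq_norm_sq]
        field_simp; ring
      rw [image_add_lower, this]
      refine ⟨hvm, fun τ' hτ' => ?_⟩
      rw [image_add_lower] at hτ' ⊢
      have h1 : inner ℝ a v ≤ c + inner ℝ a τ' := hτ' (subset_convexHull ℝ _ hv)
      exact fun y hy => le_trans hy h1
    · exact ⟨0, fun h => absurd h hs⟩
  choose τ hτ using hτ
  refine ⟨(V.finite_toSet.isCompact_convexHull ℝ).isBounded, τ, ?_⟩
  apply Set.Subset.antisymm
  · exact Set.subset_iInter₂ fun s hs => (hτ s hs).1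
  · intro x hx
    by_contra hxQ
    obtain ⟨a, c, ha, hac, hlt⟩ := hsep x hxQ
    have hs : lower a c ∈ halfSpaces H := ⟨a, c, ha, hac, rfl⟩
    obtain ⟨v, hv, hvm⟩ := hmax a
    have h1 := (hτ _ hs).2 (((inner ℝ a v - c) / ‖a‖ ^ 2) • a)
    have : c + inner ℝ a (((inner ℝ a v - c) / ‖a‖ ^ 2) • a) = inner ℝ a v := by
      have : ‖a‖ ≠ 0 := norm_ne_zero_iff.2 ha
      rw [real_inner_smul_right, real_inner_self_eq_norm_sq]
      field_simp; ring
    rw [image_add_lower a c (((inner ℝ a v - c) / ‖a‖ ^ 2) • a), this] at h1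
    have h2 : inner ℝ a x ≤ inner ℝ a v := h1 hvm (Set.mem_iInter₂.1 hx _ hs)
    exact absurd (hlt v hv) (not_lt.2 h2)

lemma arctan_arg_pos {ε : ℝ} (hε : 0 < ε) {d : ℕ} (hd : 2 ≤ d) :
    0 < ε / √((d : ℝ) ^ 2 - 1) := by
  have : (2 : ℝ) ≤ d := by exact_mod_cast hd
  have : 0 < √((d : ℝ) ^ 2 - 1) := Real.sqrt_pos.2 (by nlinarith)
  positivity

lemma kConst_pos {ε : ℝ} (hε : 0 < ε) {d : ℕ} (hd : 1 ≤ d) : 0 < kConst ε d := by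
  rcases hd.eq_or_lt with rfl | hd2
  · simp [kConst]
  · have h1 := arctan_arg_pos hε hd2
    have h2 : 0 < arctan (ε / √((d : ℝ) ^ 2 - 1)) := Real.arctan_pos.2 h1
    have h3 : 0 < ⌈2 * π / arctan (ε / √((d : ℝ) ^ 2 - 1))⌉₊ :=
      Nat.ceil_pos.2 (by positivity)
    have h4 : (0 : ℝ) < ⌈2 * π / arctan (ε / √((d : ℝ) ^ 2 - 1))⌉₊ := by exact_mod_cast h3
    have h5 : (0 : ℝ) < √(d : ℝ) := Real.sqrt_pos.2 (by exact_mod_cast hd)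
    unfold kConst
    positivity

lemma granularity_pos {ε : ℝ} (hε : 0 < ε) {d : ℕ} (hd : 1 ≤ d) : 0 < granularity ε d := by
  have := kConst_pos hε hd
  have h5 : (0 : ℝ) < √(d : ℝ) := Real.sqrt_pos.2 (by exact_mod_cast hd)
  unfold granularity
  positivity

lemma zero_mem_gridPoints (ε : ℝ) (d : ℕ) : (0 : E d) ∈ gridPoints ε d :=
  ⟨fun _ => 0, by simp, by simp⟩

/-- The grid points affinely span the space. -/
lemma span_sub_gridPoints {ε : ℝ} (hε : 0 < ε) {d : ℕ} (hd : 1 ≤ d) (x : E d) :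
    Submodule.span ℝ ((fun g => x - g) '' gridPoints ε d) = ⊤ := by
  have hg := granularity_pos hε hd
  rw [eq_top_iff, ← (EuclideanSpace.basisFun (Fin d) ℝ).toBasis.span_eq, Submodule.span_le]
  rintro _ ⟨i, rfl⟩
  have h1 : granularity ε d • EuclideanSpace.single i (1 : ℝ) ∈ gridPoints ε d := by
    refine ⟨fun j => if j = i then 1 else 0, fun j => ?_, fun j => ?_⟩
    · have : 1 ≤ ⌈1 / granularity ε d⌉₊ := Nat.one_le_ceil_iff.2 (by positivity)
      dsimp only; split_ifs <;> omega
    · simp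
  have h2 := Submodule.sub_mem _
    (Submodule.subset_span (R := ℝ) (Set.mem_image_of_mem (fun g => x - g)
      (zero_mem_gridPoints ε d)))
    (Submodule.subset_span (R := ℝ) (Set.mem_image_of_mem (fun g => x - g) h1))
  have h3 := Submodule.smul_mem _ (granularity ε d)⁻¹ h2
  simpa [smul_smul, hg.ne'] using h3

/-- Hulls of homothetic copies of sets of grid points are polytopes of the base set. -/
lemma convexHull_grid_mem_polytopes {ε : ℝ} (hε : 0 < ε) {d : ℕ} (hd : 1 ≤ d)
    (V : Finset (E d)) (hV : V.Nonempty) (t : E d) {r : ℝ} (hr : 0 < r)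
    (hVG : ∀ v ∈ V, ∃ g ∈ gridPoints ε d, v = t + r • g) :
    convexHull ℝ (V : Set (E d)) ∈ polytopes (baseSet ε d) := by
  classical
  refine convexHull_mem_polytopes _ V hV fun x hx => ?_
  let f : E d →ᵃ[ℝ] E d := r⁻¹ • (AffineMap.id ℝ (E d) - AffineMap.const ℝ (E d) t)
  have hf : ∀ y, f y = r⁻¹ • (y - t) := fun y => by simp [f]
  have hinv : ∀ y, y = t + r • f y := fun y => by
    rw [hf, smul_smul, mul_inv_cancel₀ hr.ne', one_smul]; abel
  have hfi : Function.Injective f := fun y z h => by rw [hinv y, hinv z, h]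
  have hx' : f x ∉ convexHull ℝ ((V.image f : Finset (E d)) : Set (E d)) := by
    rw [Finset.coe_image, ← AffineMap.image_convexHull]
    rintro ⟨y, hy, hyx⟩
    exact hx (hfi hyx ▸ hy)
  obtain ⟨a, c, ha, ⟨p, hp1, hp2, hp3⟩, hlt⟩ := exists_separating_level hd (gridPoints ε d)
    (span_sub_gridPoints hε hd) (V.image f) (by
      intro y hy
      obtain ⟨v, hv, rfl⟩ := Finset.mem_image.1 (Finset.mem_coe.1 hy)
      obtain ⟨g, hg, rfl⟩ := hVG v hv
      rw [hf]
      simpa [smul_smul, hr.ne'] using hg) hx'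
  refine ⟨a, c, ha, ⟨p, hp1, ⟨a, c, ha, rfl⟩, hp2, hp3⟩, fun v hv => ?_⟩
  have h1 := hlt _ (Finset.mem_image_of_mem f hv)
  rw [hinv v, hinv x, inner_add_right, inner_add_right, real_inner_smul_right,
    real_inner_smul_right]
  have := mul_lt_mul_of_pos_left h1 hr
  linarith

/-! ### Coordinates adapted to a finite set -/

/-- A finite set `W` has affine coordinates, given by differences `a i - b i` of points of `W`,
in which its width is exactly `1` in every coordinate direction: choose the differences so that
they span a parallelepiped of maximal volume and use Cramer's rule. -/
lemma exists_extremal_coordinates {F : Type*} [AddCommGroup F] [Module ℝ F]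
    [FiniteDimensional ℝ F] (W : Finset F) :
    ∃ r ≤ Module.finrank ℝ F, ∃ (a b : Fin r → F) (f : F →ₗ[ℝ] (Fin r → ℝ)),
      (∀ i, a i ∈ W) ∧ (∀ i, b i ∈ W) ∧ (∀ i, f (a i) - f (b i) = Pi.single i 1) ∧
      (∀ w ∈ W, ∀ w' ∈ W, ∀ i, f w i - f w' i ≤ 1) ∧
      (∀ w ∈ W, ∀ w' ∈ W, w - w' = ∑ i, (f w i - f w' i) • (a i - b i)) := by
  classical
  let δ : W × W → F := fun p => p.1 - p.2
  let U := Submodule.span ℝ (Set.range δ)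
  have hδU : ∀ p, δ p ∈ U := fun p => Submodule.subset_span ⟨p, rfl⟩
  let δ' : W × W → U := fun p => ⟨δ p, hδU p⟩
  have hspan : Submodule.span ℝ (Set.range δ') = ⊤ := by
    have : Set.range δ' = ((↑) : U → F) ⁻¹' Set.range δ := by
      ext x
      simp [δ', Subtype.ext_iff]
    rw [this]
    exact Submodule.span_span_coe_preimage
  let r := Module.finrank ℝ U
  let e : Module.Basis (Fin r) ℝ U := Module.finBasis ℝ U
  obtain ⟨v₀, hv₀⟩ : ∃ v : Fin r → W × W, e.det (δ' ∘ v) ≠ 0 := by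
    obtain ⟨s, hs, hss, hsi⟩ := exists_linearIndependent ℝ (Set.range δ')
    let B : Module.Basis s ℝ U := Module.Basis.mk hsi (by
      simp only [Subtype.range_coe_subtype, Set.ofPred_mem_eq]
      rw [hss, hspan])
    have : Finite s := Module.Finite.finite_basis B
    have hcard : Nat.card s = r := (Module.finrank_eq_nat_card_basis B).symm
    let q : Fin r ≃ s := (Finite.equivFinOfCardEq hcard).symm
    choose v hv using fun i : Fin r => hs (q i).2
    refine ⟨v, ?_⟩
    have h1 : δ' ∘ v = B.reindex q.symm := by
      ext i : 1
      rw [Function.comp_apply, hv]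
      simp [B]
    rw [h1]
    exact (e.isUnit_det _).ne_zero
  have : Nonempty (Fin r → W × W) := ⟨v₀⟩
  obtain ⟨v, hv⟩ := Finite.exists_max (fun v : Fin r → W × W => |e.det (δ' ∘ v)|)
  have hv0 : e.det (δ' ∘ v) ≠ 0 := by
    have := (abs_pos.2 hv₀).trans_le (hv v₀)
    exact abs_pos.1 this
  obtain ⟨hli, hsp⟩ := (e.is_basis_iff_det).2 (isUnit_iff_ne_zero.2 hv0)
  let B : Module.Basis (Fin r) ℝ U := Module.Basis.mk hli hsp.ge
  have hBv : ∀ i, B i = δ' (v i) := fun i => by simp [B]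
  have hcoord : ∀ p i, |B.repr (δ' p) i| ≤ 1 := by
    intro p i
    have h1 := congrArg (fun g => g (δ' p)) (e.det_smul_mk_coord_eq_det_update hli hsp.ge i)
    have h2 : e.det (δ' ∘ v) * B.repr (δ' p) i = e.det (δ' ∘ Function.update v i p) := by
      rw [Function.comp_update]
      exact h1
    have h3 := hv (Function.update v i p)
    rw [← h2, abs_mul] at h3
    have h4 := abs_pos.2 hv0
    nlinarith
  obtain ⟨f, hf⟩ := LinearMap.exists_extend (B.equivFun : U →ₗ[ℝ] (Fin r → ℝ))
  have hfU : ∀ u : U, f u = B.equivFun u := fun u => by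
    rw [← LinearEquiv.coe_coe, ← hf]; rfl
  have hfd : ∀ p : W × W, f p.1 - f p.2 = B.equivFun (δ' p) := fun p => by
    rw [← map_sub, ← hfU]
  refine ⟨r, Submodule.finrank_le U, fun i => (v i).1, fun i => (v i).2, f, fun i => (v i).1.2,
    fun i => (v i).2.2, fun i => ?_, fun w hw w' hw' i => ?_, fun w hw w' hw' => ?_⟩
  · rw [hfd, ← hBv]
    ext j
    simp [Pi.single_apply, eq_comm]
  · have h1 := congrFun (hfd (⟨w, hw⟩, ⟨w', hw'⟩)) i
    simp only [Pi.sub_apply] at h1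
    rw [h1]
    exact (le_abs_self _).trans (hcoord _ _)
  · have h1 := hfd (⟨w, hw⟩, ⟨w', hw'⟩)
    have h2 := B.sum_equivFun (δ' (⟨w, hw⟩, ⟨w', hw'⟩))
    rw [← h1] at h2
    have h3 := congrArg (Subtype.val) h2
    simp only [AddSubmonoidClass.coe_finsetSum, Submodule.coe_smul, hBv] at h3
    exact h3.symm

/-! ### Approximation by few points: radial cells -/

/-- One maximizer of `t` is selected in each nonempty class of `C`. -/
lemma exists_class_maximizers {α β : Type*} [Fintype β] (A : Finset α) (C : α → β)
    (t : α → ℝ) : ∃ S ⊆ A, S.card ≤ Fintype.card β ∧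
      ∀ x ∈ A, ∃ p ∈ S, C p = C x ∧ t x ≤ t p := by
  classical
  rcases A.eq_empty_or_nonempty with rfl | hA
  · exact ⟨∅, by simp, by simp, by simp⟩
  have h : ∀ c : β, ∃ p : α, (∃ x ∈ A, C x = c) → p ∈ A ∧ C p = c ∧
      ∀ x ∈ A, C x = c → t x ≤ t p := by
    intro c
    by_cases hc : ∃ x ∈ A, C x = c
    · obtain ⟨p, hp, hpm⟩ := (A.filter fun x => C x = c).exists_max_image t
        (by obtain ⟨x, hx, hxc⟩ := hc; exact ⟨x, by simp [hx, hxc]⟩)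
      rw [Finset.mem_filter] at hp
      exact ⟨p, fun _ => ⟨hp.1, hp.2, fun x hx hxc => hpm x (by simp [hx, hxc])⟩⟩
    · exact ⟨hA.choose, fun h => absurd h hc⟩
  choose p hp using h
  refine ⟨(A.image C).image p, ?_, ?_, ?_⟩
  · intro y hy
    obtain ⟨c, hc, rfl⟩ := Finset.mem_image.1 hy
    exact (hp c (by simpa using hc)).1
  · exact Finset.card_image_le.trans (Finset.card_le_univ _)
  · intro x hx
    have h1 := hp (C x) ⟨x, hx, rfl⟩
    exact ⟨p (C x), Finset.mem_image_of_mem _ (Finset.mem_image_of_mem _ hx), h1.2.1,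
      h1.2.2 x hx rfl⟩

/-- The unit interval is covered by `n` intervals of length `1 / n`. -/
lemma exists_interval_index {n : ℕ} (hn : 1 ≤ n) {u : ℝ} (h0 : 0 ≤ u) (h1 : u ≤ 1) :
    ∃ k : Fin n, (k : ℝ) / n ≤ u ∧ u ≤ (k + 1) / n := by
  have hn' : (0 : ℝ) < n := by exact_mod_cast hn
  rcases h1.eq_or_lt with rfl | h1
  · refine ⟨⟨n - 1, by omega⟩, ?_, ?_⟩
    · rw [div_le_one hn']; push_cast [Nat.cast_sub hn]; linarith
    · rw [le_div_iff₀ hn']; push_cast [Nat.cast_sub hn]; linarith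
  · have hnu : 0 ≤ u * n := by positivity
    refine ⟨⟨⌊u * n⌋₊, ?_⟩, ?_, ?_⟩
    · rw [Nat.floor_lt hnu]; nlinarith
    · rw [div_le_iff₀ hn']; exact Nat.floor_le hnu
    · rw [le_div_iff₀ hn']; exact (Nat.lt_floor_add_one _).le

lemma combination_mem {F : Type*} [AddCommGroup F] [Module ℝ F] {Q : Set F} (hQ : Convex ℝ Q)
    {o p z : F} (ho : o ∈ Q) (hp : p ∈ Q) (hz : z ∈ Q) {τ δ : ℝ} (h0 : 0 ≤ τ) (h1 : τ ≤ 1)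
    (hδ : 0 ≤ δ) : o + (1 + δ)⁻¹ • (τ • (p - o) + δ • (z - o)) ∈ Q := by
  have hp' : o + τ • (p - o) ∈ Q := hQ.add_smul_sub_mem ho hp ⟨h0, h1⟩
  have h2 : (1 + δ) ≠ 0 := by positivity
  have := hQ hp' hz (a := (1 + δ)⁻¹) (b := (1 + δ)⁻¹ * δ) (by positivity) (by positivity)
    (by field_simp)
  convert this using 1
  have h3 : o = ((1 + δ)⁻¹ + (1 + δ)⁻¹ * δ) • o := by
    rw [show (1 + δ)⁻¹ + (1 + δ)⁻¹ * δ = 1 by field_simp, one_smul]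
  nth_rewrite 1 [h3]
  module

/-- Approximation of a finite set `A` whose width is `1` in all coordinate directions. With
`r` the dimension, `o` the average of the midpoints of the chords `[b i, a i]`, the hull of the
chords contains a cube of half side `1 / (2 r)` about `o`. The bounding unit cube of `A` is cut
into cones with apex `o` over `2 r n ^ (r - 1)` boundary cells of side `1 / n`, and in each cone
the point of `A` that lies farthest out is selected. A point of the same cone differs from a
point on the segment between `o` and the selected point by at most `1 / n` in each coordinate,
which the small cube compensates after enlargement by the factor `1 + 2 r / n`. -/
lemma exists_radial_approximation {q : ℕ} (A : Finset (Fin (q + 1) → ℝ))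
    (a b : Fin (q + 1) → Fin (q + 1) → ℝ) (ha : ∀ i, a i ∈ A) (hb : ∀ i, b i ∈ A)
    (hab : ∀ i, a i - b i = Pi.single i 1) (hw : ∀ x ∈ A, ∀ y ∈ A, ∀ i, x i - y i ≤ 1)
    {n : ℕ} (hn : 1 ≤ n) :
    ∃ S ⊆ A, S.card ≤ 2 * (q + 1) * n ^ q + 2 * (q + 1) ∧ ∃ o, ∀ x ∈ A,
      o + (1 + 2 * (q + 1) / n : ℝ)⁻¹ • (x - o) ∈
        convexHull ℝ (S : Set (Fin (q + 1) → ℝ)) := by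
  classical
  have hn' : (0 : ℝ) < n := by exact_mod_cast hn
  have hr : (0 : ℝ) < q + 1 := by positivity
  let S₀ : Finset (Fin (q + 1) → ℝ) := Finset.univ.image a ∪ Finset.univ.image b
  have hS₀A : S₀ ⊆ A := by
    intro x hx
    rcases Finset.mem_union.1 hx with h | h <;> obtain ⟨i, -, rfl⟩ := Finset.mem_image.1 h
    exacts [ha i, hb i]
  have haS : ∀ i, a i ∈ (S₀ : Set _) := fun i => by simp [S₀]
  have hbS : ∀ i, b i ∈ (S₀ : Set _) := fun i => by simp [S₀]
  let o : Fin (q + 1) → ℝ := ∑ i, (q + 1 : ℝ)⁻¹ • ((1 / 2 : ℝ) • a i + (1 / 2 : ℝ) • b i)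
  have hcube : ∀ e : Fin (q + 1) → ℝ, (∀ i, |e i| ≤ 1 / (2 * (q + 1))) →
      o + e ∈ convexHull ℝ (S₀ : Set (Fin (q + 1) → ℝ)) := by
    intro e he
    have h1 : o + e = ∑ i, (q + 1 : ℝ)⁻¹ •
        ((1 / 2 + (q + 1) * e i) • a i + (1 / 2 - (q + 1) * e i) • b i) := by
      have h2 : e = ∑ i, (q + 1 : ℝ)⁻¹ • ((q + 1) * e i) • (a i - b i) := by
        simp only [smul_smul, hab]
        ext j
        simp [Finset.sum_apply, Pi.single_apply]
        field_simp
      conv_lhs => rw [h2]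
      rw [← Finset.sum_add_distrib]
      refine Finset.sum_congr rfl fun i _ => ?_
      module
    rw [h1]
    refine (convex_convexHull ℝ _).sum_mem (fun _ _ => by positivity) (by simp; field_simp)
      fun i _ => ?_
    have h3 := abs_le.1 (he i)
    have h4 : (q + 1 : ℝ) * (1 / (2 * (q + 1))) = 1 / 2 := by field_simp
    have h5 := mul_le_mul_of_nonneg_left h3.1 hr.le
    have h6 := mul_le_mul_of_nonneg_left h3.2 hr.le
    rw [mul_neg, h4] at h5
    rw [h4] at h6
    exact convex_convexHull ℝ _ (subset_convexHull ℝ _ (haS i)) (subset_convexHull ℝ _ (hbS i))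
      (by linarith) (by linarith) (by ring)
  have hoS : o ∈ convexHull ℝ (S₀ : Set (Fin (q + 1) → ℝ)) := by
    have := hcube 0 (fun i => by simp; positivity)
    rwa [add_zero] at this
  -- the bounding box is `[o i - α i, o i + β i]` in coordinate `i`, with `α i + β i = 1`
  let α : Fin (q + 1) → ℝ := fun i => o i - b i i
  let β : Fin (q + 1) → ℝ := fun i => b i i + 1 - o i
  have habi : ∀ i, a i i = b i i + 1 := fun i => by
    have := congrFun (hab i) i
    simp only [Pi.sub_apply, Pi.single_eq_same] at this
    linarith
  have hbox : ∀ x ∈ convexHull ℝ (A : Set (Fin (q + 1) → ℝ)), ∀ i,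
      b i i ≤ x i ∧ x i ≤ b i i + 1 := by
    intro x hx i
    have hc : Convex ℝ {x : Fin (q + 1) → ℝ | b i i ≤ x i ∧ x i ≤ b i i + 1} :=
      (convex_halfSpace_ge (LinearMap.proj (R := ℝ) i).isLinear _).inter
        (convex_halfSpace_le (LinearMap.proj (R := ℝ) i).isLinear _)
    refine convexHull_min (fun y hy => ?_) hc hx
    have h1 := hw (a i) (ha i) y hy i
    have h2 := hw y hy (b i) (hb i) i
    rw [habi] at h1
    exact ⟨by linarith, by linarith⟩
  have hαβ : ∀ i, 0 < α i ∧ 0 < β i := by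
    intro i
    have hpos : (0 : ℝ) < 1 / (2 * (q + 1)) := by positivity
    have h1 : ∀ s : ℝ, |s| = 1 / (2 * (q + 1)) → b i i ≤ o i + s ∧ o i + s ≤ b i i + 1 := by
      intro s hs
      have := hbox _ (convexHull_mono (Finset.coe_subset.2 hS₀A)
        (hcube (fun _ => s) fun _ => hs.le)) i
      simpa using this
    have h2 := h1 (1 / (2 * (q + 1))) (abs_of_pos hpos)
    have h3 := h1 (-(1 / (2 * (q + 1)))) (by rw [abs_neg, abs_of_pos hpos])
    exact ⟨by simp only [α]; linarith, by simp only [β]; linarith⟩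
  -- `t x` is the gauge of `x` with respect to the box and `y x` the point where the ray through
  -- `x` leaves the box, relative to `o`; the face that is hit there is recorded by `F x` and `s x`
  have hgauge : ∀ x : Fin (q + 1) → ℝ, ∃ (t : ℝ) (y : Fin (q + 1) → ℝ) (F : Fin (q + 1))
      (s : Bool) (c : Fin q → Fin n), x ∈ A.erase o → 0 < t ∧ t ≤ 1 ∧ x - o = t • y ∧
        (y F = if s then β F else -α F) ∧
        ∀ j, (c j : ℝ) / n ≤ y (F.succAbove j) + α (F.succAbove j) ∧
          y (F.succAbove j) + α (F.succAbove j) ≤ (c j + 1) / n := by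
    intro x
    by_cases hx : x ∈ A.erase o
    swap
    · exact ⟨0, 0, 0, true, fun _ => ⟨0, hn⟩, fun h => absurd h hx⟩
    rw [Finset.mem_erase] at hx
    let φ : Fin (q + 1) × Bool → ℝ := fun p =>
      if p.2 then (x p.1 - o p.1) / β p.1 else (o p.1 - x p.1) / α p.1
    obtain ⟨⟨F, s⟩, -, hm⟩ := Finset.univ.exists_max_image φ Finset.univ_nonempty
    set t := φ (F, s) with ht
    have hβ : ∀ i, x i - o i ≤ t * β i := fun i => by
      have := hm (i, true) (Finset.mem_univ _)
      simp only [φ, if_true] at this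
      rwa [div_le_iff₀ (hαβ i).2] at this
    have hα : ∀ i, o i - x i ≤ t * α i := fun i => by
      have := hm (i, false) (Finset.mem_univ _)
      simp only [φ, Bool.false_eq_true, if_false] at this
      rwa [div_le_iff₀ (hαβ i).1] at this
    have hxb := hbox x (subset_convexHull ℝ _ hx.2)
    have ht1 : t ≤ 1 := by
      rw [ht]
      simp only [φ]
      split_ifs
      · rw [div_le_one (hαβ F).2]; simp only [β]; linarith [(hxb F).2]
      · rw [div_le_one (hαβ F).1]; simp only [α]; linarith [(hxb F).1]
    have ht0 : 0 < t := by
      by_contra hneg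
      push Not at hneg
      apply hx.1
      ext i
      have h1 := mul_nonpos_of_nonpos_of_nonneg hneg (hαβ i).1.le
      have h2 := mul_nonpos_of_nonpos_of_nonneg hneg (hαβ i).2.le
      linarith [hα i, hβ i]
    have hy : ∀ i, 0 ≤ t⁻¹ * (x i - o i) + α i ∧ t⁻¹ * (x i - o i) + α i ≤ 1 := by
      intro i
      have e : α i + β i = 1 := by simp only [α, β]; ring
      have h1 : t⁻¹ * (x i - o i) ≤ β i := by
        rw [inv_mul_le_iff₀ ht0]; exact hβ i
      have h2 : t⁻¹ * (o i - x i) ≤ α i := by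
        rw [inv_mul_le_iff₀ ht0]; exact hα i
      have h3 : t⁻¹ * (o i - x i) = -(t⁻¹ * (x i - o i)) := by ring
      exact ⟨by linarith, by linarith⟩
    choose c hc using fun j : Fin q =>
      exists_interval_index hn (hy (F.succAbove j)).1 (hy (F.succAbove j)).2
    refine ⟨t, t⁻¹ • (x - o), F, s, c, fun _ => ⟨ht0, ht1, ?_, ?_, fun j => hc j⟩⟩
    · rw [smul_smul, mul_inv_cancel₀ ht0.ne', one_smul]
    · simp only [Pi.smul_apply, Pi.sub_apply, smul_eq_mul]
      rw [inv_mul_eq_iff_eq_mul₀ ht0.ne', ht]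
      have h1 := (hαβ F).1.ne'
      have h2 := (hαβ F).2.ne'
      cases s
      · simp only [φ, Bool.false_eq_true, if_false]; field_simp; ring
      · simp only [φ, if_true]; field_simp
  choose t y F s c hgauge using hgauge
  obtain ⟨S₁, hS₁, hS₁c, hS₁m⟩ := exists_class_maximizers (A.erase o)
    (fun x => (F x, s x, c x)) t
  refine ⟨S₁ ∪ S₀, Finset.union_subset (hS₁.trans (Finset.erase_subset _ _)) hS₀A, ?_, o, ?_⟩
  · have h1 : S₀.card ≤ (q + 1) + (q + 1) := (Finset.card_union_le _ _).trans
      (add_le_add (Finset.card_image_le.trans (by simp)) (Finset.card_image_le.trans (by simp)))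
    have h2 : Fintype.card (Fin (q + 1) × Bool × (Fin q → Fin n)) = 2 * (q + 1) * n ^ q := by
      simp; ring
    have h3 := Finset.card_union_le S₁ S₀
    omega
  intro x hxA
  have hsub : convexHull ℝ (S₀ : Set (Fin (q + 1) → ℝ)) ⊆
      convexHull ℝ ((S₁ ∪ S₀ : Finset (Fin (q + 1) → ℝ)) : Set (Fin (q + 1) → ℝ)) :=
    convexHull_mono (by simp)
  by_cases hxo : x = o
  · rw [hxo, sub_self, smul_zero, add_zero]; exact hsub hoS
  have hx : x ∈ A.erase o := Finset.mem_erase.2 ⟨hxo, hxA⟩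
  obtain ⟨p, hp, hcell, htp⟩ := hS₁m x hx
  simp only [Prod.mk.injEq] at hcell
  obtain ⟨hF, hs, hc⟩ := hcell
  obtain ⟨ht0, ht1, hxy, hface, hbd⟩ := hgauge x hx
  obtain ⟨ht0', -, hpy, hface', hbd'⟩ := hgauge p (hS₁ hp)
  have hyy : ∀ i, |y x i - y p i| ≤ 1 / n := by
    intro i
    rw [hF] at hface' hbd'
    rw [hs] at hface'
    rw [hc] at hbd'
    rcases Fin.eq_self_or_eq_succAbove (F x) i with rfl | ⟨j, rfl⟩
    · rw [hface, hface', sub_self, abs_zero]; positivity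
    · have h1 := hbd j
      have h2 := hbd' j
      have h3 : ((c x j : ℝ) + 1) / n = c x j / n + 1 / n := by ring
      rw [abs_le]
      constructor <;> linarith [h1.1, h1.2, h2.1, h2.2]
  have hz := hcube (((n : ℝ) / (2 * (q + 1)) * t x) • (y x - y p)) (by
    intro i
    rw [Pi.smul_apply, smul_eq_mul, abs_mul, abs_of_nonneg (by positivity), Pi.sub_apply]
    calc (n : ℝ) / (2 * (q + 1)) * t x * |y x i - y p i|
        ≤ (n : ℝ) / (2 * (q + 1)) * 1 * (1 / n) := by gcongr; exact hyy i
      _ = 1 / (2 * (q + 1)) := by field_simp)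
  have hpS : p ∈ convexHull ℝ ((S₁ ∪ S₀ : Finset (Fin (q + 1) → ℝ)) : Set (Fin (q + 1) → ℝ)) :=
    subset_convexHull ℝ _ (by simp [hp])
  have := combination_mem (convex_convexHull ℝ _) (hsub hoS) hpS (hsub hz)
    (τ := t x / t p) (δ := 2 * (q + 1) / n) (by positivity) ((div_le_one ht0').2 htp)
    (by positivity)
  convert this using 3
  rw [hpy, hxy, add_sub_cancel_left, smul_smul, smul_smul, div_mul_cancel₀ _ ht0'.ne']
  rw [show (2 * (q + 1) / n : ℝ) * (n / (2 * (q + 1)) * t x) = t x by field_simp]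
  rw [← smul_add, add_sub_cancel]

/-! ### Approximation in the plane: supporting lines -/

/-- Support function of a set in the quadrant, for directions `(w, 1)` with `0 ≤ w ≤ 1`: the
points `pick j` that are extreme in the directions `(j / n, 1)` serve for all of them. Points
outside the quadrant are dominated by the point `e` on the axis. -/
lemma exists_support_half {α : Type*} (A : Finset α) (X Y : α → ℝ) (hX : ∀ x ∈ A, X x ≤ 1)
    (hY : ∀ x ∈ A, Y x ≤ 1) {e : α} (heA : e ∈ A) (heX : X e = 0) (heY : Y e = 1)
    {n : ℕ} (hn : 1 ≤ n) (pick : ℕ → α)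
    (hpick : ∀ j, pick j ∈ A ∧ 0 ≤ X (pick j) ∧ ∀ x ∈ A, 0 ≤ X x → 0 ≤ Y x →
      j * X x + n * Y x ≤ j * X (pick j) + n * Y (pick j))
    {w : ℝ} (hw0 : 0 ≤ w) (hw1 : w ≤ 1) {x : α} (hx : x ∈ A) :
    ∃ p, (p = e ∨ ∃ j, 1 ≤ j ∧ j ≤ n ∧ p = pick j) ∧
      w * X x + Y x ≤ (1 + 1 / (2 * n)) * (w * X p + Y p) := by
  have hn' : (0 : ℝ) < n := by exact_mod_cast hn
  have hδ : (0 : ℝ) < 1 / (2 * n) := by positivity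
  have he : ∀ s : ℝ, s ≤ 1 + 1 / (2 * n) → s ≤ (1 + 1 / (2 * n)) * (w * X e + Y e) := by
    intro s hs; rw [heX, heY]; linarith
  by_cases hx0 : X x < 0
  · refine ⟨e, Or.inl rfl, he _ ?_⟩
    have := mul_nonpos_of_nonneg_of_nonpos hw0 hx0.le
    linarith [hY x hx]
  by_cases hy0 : Y x < 0
  · refine ⟨e, Or.inl rfl, he _ ?_⟩
    have := mul_le_mul hw1 (hX x hx) (by linarith) zero_le_one
    linarith
  push Not at hx0 hy0
  obtain ⟨j, hjn, hj⟩ : ∃ j : ℕ, j ≤ n ∧ |w * n - j| ≤ 1 / 2 := by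
    refine ⟨⌊w * n + 1 / 2⌋₊, ?_, ?_⟩
    · rw [← Nat.lt_add_one_iff, Nat.floor_lt (by positivity)]
      push_cast
      nlinarith
    · have h1 := Nat.floor_le (show 0 ≤ w * n + 1 / 2 by positivity)
      have h2 := Nat.lt_floor_add_one (w * n + 1 / 2)
      rw [abs_le]; constructor <;> linarith
  have hmain : ∀ p, p ∈ A → 0 ≤ X p → j * X x + n * Y x ≤ j * X p + n * Y p →
      w * X x + Y x ≤ w * X p + Y p + 1 / (2 * n) := by
    intro p hp hpX hmax
    have h1 : |X x - X p| ≤ 1 := by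
      rw [abs_le]; constructor <;> linarith [hX x hx, hX p hp]
    have h2 : (w * n - j) * (X x - X p) ≤ 1 / 2 := by
      refine (le_abs_self _).trans ?_
      rw [abs_mul]
      calc |w * n - j| * |X x - X p| ≤ 1 / 2 * 1 := by gcongr
        _ = 1 / 2 := by ring
    have h3 : n * (w * X x + Y x) ≤ n * (w * X p + Y p + 1 / (2 * n)) := by
      have : (n : ℝ) * (1 / (2 * n)) = 1 / 2 := by field_simp
      linarith
    exact le_of_mul_le_mul_left h3 hn'
  rcases Nat.eq_zero_or_pos j with rfl | hj1
  · refine ⟨e, Or.inl rfl, he _ ?_⟩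
    have := hmain e heA heX.ge (by
      simp only [Nat.cast_zero, zero_mul, zero_add]
      exact mul_le_mul_of_nonneg_left ((hY x hx).trans heY.ge) hn'.le)
    rw [heX, heY] at this
    linarith
  · obtain ⟨h1, h2, h3⟩ := hpick j
    have h4 := hmain _ h1 h2 (h3 x hx hx0 hy0)
    rcases le_total 1 (w * X (pick j) + Y (pick j)) with h | h
    · refine ⟨pick j, Or.inr ⟨j, hj1, hjn, rfl⟩, h4.trans ?_⟩
      have := mul_le_mul_of_nonneg_left h hδ.le
      linarith
    · exact ⟨e, Or.inl rfl, he _ (by linarith)⟩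

/-- Approximation of the support function in one quadrant of directions. The point `e₁` attains
the maximum of `X` on the axis `Y = 0` and `e₂` that of `Y` on the axis `X = 0`. -/
lemma exists_support_quadrant {α : Type*} (A : Finset α) (X Y : α → ℝ) {e₁ e₂ : α}
    (h₁A : e₁ ∈ A) (h₂A : e₂ ∈ A) (h₁Y : Y e₁ = 0) (h₂X : X e₂ = 0)
    (hX : ∀ x ∈ A, X x ≤ X e₁) (hY : ∀ x ∈ A, Y x ≤ Y e₂) {n : ℕ} (hn : 1 ≤ n) :
    ∃ S ⊆ A, S.card ≤ 2 * n - 1 ∧ ∀ u v : ℝ, 0 ≤ u → 0 ≤ v → ∀ x ∈ A,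
      ∃ p, (p ∈ S ∨ p = e₁ ∨ p = e₂) ∧
        u * X x + v * Y x ≤ (1 + 1 / (2 * n)) * (u * X p + v * Y p) := by
  classical
  have hδ : (0 : ℝ) ≤ 1 / (2 * n) := by positivity
  have hX0 : 0 ≤ X e₁ := h₂X ▸ hX e₂ h₂A
  have hY0 : 0 ≤ Y e₂ := h₁Y ▸ hY e₁ h₁A
  -- if the quadrant degenerates, one of the two given points is a maximizer
  have hdeg₁ : ∀ u v : ℝ, 0 ≤ u → 0 ≤ v → u * X e₁ = 0 → ∀ x ∈ A,
      u * X x + v * Y x ≤ (1 + 1 / (2 * n)) * (u * X e₂ + v * Y e₂) := by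
    intro u v hu hv h0 x hx
    have h1 := mul_le_mul_of_nonneg_left (hX x hx) hu
    have h2 := mul_le_mul_of_nonneg_left (hY x hx) hv
    have h3 := mul_nonneg hδ (mul_nonneg hv hY0)
    rw [h₂X]; linarith
  have hdeg₂ : ∀ u v : ℝ, 0 ≤ u → 0 ≤ v → v * Y e₂ = 0 → ∀ x ∈ A,
      u * X x + v * Y x ≤ (1 + 1 / (2 * n)) * (u * X e₁ + v * Y e₁) := by
    intro u v hu hv h0 x hx
    have h1 := mul_le_mul_of_nonneg_left (hX x hx) hu
    have h2 := mul_le_mul_of_nonneg_left (hY x hx) hv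
    have h3 := mul_nonneg hδ (mul_nonneg hu hX0)
    rw [h₁Y]; linarith
  rcases hX0.eq_or_lt with h0 | hXp
  · exact ⟨∅, by simp, by simp, fun u v hu hv x hx => ⟨e₂, by simp, hdeg₁ u v hu hv
      (by rw [← h0, mul_zero]) x hx⟩⟩
  rcases hY0.eq_or_lt with h0 | hYp
  · exact ⟨∅, by simp, by simp, fun u v hu hv x hx => ⟨e₁, by simp, hdeg₂ u v hu hv
      (by rw [← h0, mul_zero]) x hx⟩⟩
  let X' : α → ℝ := fun x => X x / X e₁
  let Y' : α → ℝ := fun x => Y x / Y e₂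
  have hX' : ∀ x ∈ A, X' x ≤ 1 := fun x hx => (div_le_one hXp).2 (hX x hx)
  have hY' : ∀ x ∈ A, Y' x ≤ 1 := fun x hx => (div_le_one hYp).2 (hY x hx)
  have hXX : ∀ x, X x = X' x * X e₁ := fun x => by simp only [X']; field_simp
  have hYY : ∀ x, Y x = Y' x * Y e₂ := fun x => by simp only [Y']; field_simp
  have hpick : ∀ ij : ℕ × ℕ, ∃ p ∈ A, 0 ≤ X' p ∧ 0 ≤ Y' p ∧ ∀ x ∈ A, 0 ≤ X' x → 0 ≤ Y' x →
      ij.1 * X' x + ij.2 * Y' x ≤ ij.1 * X' p + ij.2 * Y' p := by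
    intro ij
    obtain ⟨p, hp, hpm⟩ := (A.filter fun x => 0 ≤ X' x ∧ 0 ≤ Y' x).exists_max_image
      (fun x => ij.1 * X' x + ij.2 * Y' x)
      ⟨e₁, by simp [h₁A, X', Y', h₁Y, hXp.ne']⟩
    rw [Finset.mem_filter] at hp
    exact ⟨p, hp.1, hp.2.1, hp.2.2, fun x hx h1 h2 => hpm x (by simp [hx, h1, h2])⟩
  choose pick hpA hpX hpY hpm using hpick
  let N : Finset (ℕ × ℕ) := (Finset.Icc 1 n).image (fun j => (j, n)) ∪
    (Finset.Icc 1 (n - 1)).image (fun j => (n, j))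
  refine ⟨N.image pick, ?_, ?_, ?_⟩
  · intro p hp
    obtain ⟨ij, -, rfl⟩ := Finset.mem_image.1 hp
    exact hpA ij
  · have h1 : N.card ≤ n + (n - 1) := (Finset.card_union_le _ _).trans
      (add_le_add (Finset.card_image_le.trans (by simp)) (Finset.card_image_le.trans (by simp)))
    have := Finset.card_image_le (s := N) (f := pick)
    omega
  intro u v hu hv x hx
  have hu' : 0 ≤ u * X e₁ := mul_nonneg hu hX0
  have hv' : 0 ≤ v * Y e₂ := mul_nonneg hv hY0
  have hval : ∀ p, u * X p + v * Y p = (u * X e₁) * X' p + (v * Y e₂) * Y' p := fun p => by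
    rw [hXX p, hYY p]; ring
  rcases hu'.eq_or_lt with h0 | hup
  · exact ⟨e₂, by simp, hdeg₁ u v hu hv h0.symm x hx⟩
  rcases hv'.eq_or_lt with h0 | hvp
  · exact ⟨e₁, by simp, hdeg₂ u v hu hv h0.symm x hx⟩
  set u' := u * X e₁
  set v' := v * Y e₂
  rcases le_total u' v' with h | h
  · obtain ⟨p, hp, hle⟩ := exists_support_half A X' Y' hX' hY' h₂A (by simp [X', h₂X])
      (by simp [Y', hYp.ne']) hn (fun j => pick (j, n))
      (fun j => ⟨hpA _, hpX _, hpm (j, n)⟩) (div_nonneg hup.le hvp.le)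
      ((div_le_one hvp).2 h) hx
    refine ⟨p, ?_, ?_⟩
    · rcases hp with rfl | ⟨j, hj1, hjn, rfl⟩
      · simp
      · exact Or.inl (Finset.mem_image_of_mem _ (Finset.mem_union_left _
          (Finset.mem_image_of_mem _ (Finset.mem_Icc.2 ⟨hj1, hjn⟩))))
    · rw [hval, hval]
      have h1 := mul_le_mul_of_nonneg_left hle hvp.le
      have e1 : ∀ q, v' * (u' / v' * X' q + Y' q) = u' * X' q + v' * Y' q := fun q => by
        field_simp
      rw [e1, mul_left_comm, e1] at h1
      exact h1
  · obtain ⟨p, hp, hle⟩ := exists_support_half A Y' X' hY' hX' h₁A (by simp [Y', h₁Y])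
      (by simp [X', hXp.ne']) hn (fun j => pick (n, j))
      (fun j => ⟨hpA _, hpY _, fun x hx h1 h2 => by linarith [hpm (n, j) x hx h2 h1]⟩)
      (div_nonneg hvp.le hup.le) ((div_le_one hup).2 h) hx
    refine ⟨p, ?_, ?_⟩
    · rcases hp with rfl | ⟨j, hj1, hjn, rfl⟩
      · simp
      · refine Or.inl (Finset.mem_image_of_mem _ ?_)
        rcases hjn.eq_or_lt with rfl | hlt
        · exact Finset.mem_union_left _
            (Finset.mem_image_of_mem (fun i => (i, j)) (Finset.mem_Icc.2 ⟨hj1, le_rfl⟩))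
        · exact Finset.mem_union_right _
            (Finset.mem_image_of_mem _ (Finset.mem_Icc.2 ⟨hj1, by omega⟩))
    · rw [hval, hval]
      have h1 := mul_le_mul_of_nonneg_left hle hup.le
      have e1 : ∀ q, u' * (v' / u' * Y' q + X' q) = u' * X' q + v' * Y' q := fun q => by
        field_simp; ring
      rw [e1, mul_left_comm, e1] at h1
      exact h1

/-- Approximation of a finite planar set `A` whose width is `1` in both coordinate directions. Its
two chords of full width cross, and they divide the directions into four quadrants. -/
lemma exists_planar_approximation (A : Finset (Fin 2 → ℝ))
    (a b : Fin 2 → Fin 2 → ℝ) (ha : ∀ i, a i ∈ A) (hb : ∀ i, b i ∈ A)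
    (hab : ∀ i, a i - b i = Pi.single i 1) (hw : ∀ x ∈ A, ∀ y ∈ A, ∀ i, x i - y i ≤ 1)
    {n : ℕ} (hn : 1 ≤ n) :
    ∃ S ⊆ A, S.card ≤ 8 * n ∧ ∃ o, ∀ x ∈ A,
      o + (1 + 1 / (2 * n) : ℝ)⁻¹ • (x - o) ∈ convexHull ℝ (S : Set (Fin 2 → ℝ)) := by
  classical
  have h00 : a 0 0 - b 0 0 = 1 := by simpa using congrFun (hab 0) 0
  have h01 : a 0 1 - b 0 1 = 0 := by simpa using congrFun (hab 0) 1
  have h10 : a 1 0 - b 1 0 = 0 := by simpa using congrFun (hab 1) 0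
  have h11 : a 1 1 - b 1 1 = 1 := by simpa using congrFun (hab 1) 1
  let o : Fin 2 → ℝ := ![a 1 0, a 0 1]
  let X : (Fin 2 → ℝ) → ℝ := fun x => x 0 - a 1 0
  let Y : (Fin 2 → ℝ) → ℝ := fun x => x 1 - a 0 1
  have hXa : ∀ x ∈ A, X x ≤ X (a 0) := fun x hx => by
    have := hw x hx (b 0) (hb 0) 0; simp only [X]; linarith
  have hXb : ∀ x ∈ A, -X x ≤ -X (b 0) := fun x hx => by
    have := hw (a 0) (ha 0) x hx 0; simp only [X]; linarith
  have hYa : ∀ x ∈ A, Y x ≤ Y (a 1) := fun x hx => by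
    have := hw x hx (b 1) (hb 1) 1; simp only [Y]; linarith
  have hYb : ∀ x ∈ A, -Y x ≤ -Y (b 1) := fun x hx => by
    have := hw (a 1) (ha 1) x hx 1; simp only [Y]; linarith
  have e1 : Y (a 0) = 0 := by simp [Y]
  have e2 : X (a 1) = 0 := by simp [X]
  have e3 : Y (b 0) = 0 := by simp only [Y]; linarith
  have e4 : X (b 1) = 0 := by simp only [X]; linarith
  obtain ⟨S₁, hS₁, hc₁, h₁⟩ := exists_support_quadrant A X Y (ha 0) (ha 1) e1 e2 hXa hYa hn
  obtain ⟨S₂, hS₂, hc₂, h₂⟩ := exists_support_quadrant A (fun x => -X x) Y (hb 0) (ha 1) e3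
    (by simp [e2]) hXb hYa hn
  obtain ⟨S₃, hS₃, hc₃, h₃⟩ := exists_support_quadrant A X (fun x => -Y x) (ha 0) (hb 1)
    (by simp [e1]) e4 hXa hYb hn
  obtain ⟨S₄, hS₄, hc₄, h₄⟩ := exists_support_quadrant A (fun x => -X x) (fun x => -Y x)
    (hb 0) (hb 1) (by simp [e3]) (by simp [e4]) hXb hYb hn
  let S : Finset (Fin 2 → ℝ) := ((S₁ ∪ S₂) ∪ (S₃ ∪ S₄)) ∪ {a 0, a 1, b 0, b 1}
  refine ⟨S, ?_, ?_, o, ?_⟩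
  · refine Finset.union_subset (Finset.union_subset (Finset.union_subset hS₁ hS₂)
      (Finset.union_subset hS₃ hS₄)) ?_
    intro x hx
    simp only [Finset.mem_insert, Finset.mem_singleton] at hx
    rcases hx with rfl | rfl | rfl | rfl
    exacts [ha 0, ha 1, hb 0, hb 1]
  · have g1 : S.card ≤ _ := Finset.card_union_le _ _
    have g2 := Finset.card_union_le (S₁ ∪ S₂) (S₃ ∪ S₄)
    have g3 := Finset.card_union_le S₁ S₂
    have g4 := Finset.card_union_le S₃ S₄
    have g5 : ({a 0, a 1, b 0, b 1} : Finset (Fin 2 → ℝ)).card ≤ 4 := Finset.card_le_four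
    omega
  have hsupp : ∀ u v : ℝ, ∀ x ∈ A, ∃ p ∈ S,
      u * X x + v * Y x ≤ (1 + 1 / (2 * n)) * (u * X p + v * Y p) := by
    intro u v x hx
    rcases le_total 0 u with hu | hu <;> rcases le_total 0 v with hv | hv
    · obtain ⟨p, hp, hle⟩ := h₁ u v hu hv x hx
      refine ⟨p, ?_, hle⟩
      rcases hp with hp | rfl | rfl <;> simp [S, *]
    · obtain ⟨p, hp, hle⟩ := h₃ u (-v) hu (by linarith) x hx
      refine ⟨p, ?_, ?_⟩
      · rcases hp with hp | rfl | rfl <;> simp [S, *]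
      · simpa only [neg_mul_neg] using hle
    · obtain ⟨p, hp, hle⟩ := h₂ (-u) v (by linarith) hv x hx
      refine ⟨p, ?_, ?_⟩
      · rcases hp with hp | rfl | rfl <;> simp [S, *]
      · simpa only [neg_mul_neg] using hle
    · obtain ⟨p, hp, hle⟩ := h₄ (-u) (-v) (by linarith) (by linarith) x hx
      refine ⟨p, ?_, ?_⟩
      · rcases hp with hp | rfl | rfl <;> simp [S, *]
      · simpa only [neg_mul_neg] using hle
  intro x hx
  by_contra hcon
  obtain ⟨f, s, hfs, hsx⟩ := geometric_hahn_banach_closed_point (convex_convexHull ℝ _)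
    (S.finite_toSet.isClosed_convexHull ℝ) hcon
  have hf : ∀ y, f (y - o) = f (Pi.single 0 1) * X y + f (Pi.single 1 1) * Y y := by
    intro y
    have : y - o = X y • Pi.single 0 1 + Y y • Pi.single 1 1 := by
      ext i; fin_cases i <;> simp [X, Y, o]
    rw [this, map_add, map_smul, map_smul, smul_eq_mul, smul_eq_mul]; ring
  obtain ⟨p, hp, hle⟩ := hsupp (f (Pi.single 0 1)) (f (Pi.single 1 1)) x hx
  rw [← hf, ← hf] at hle
  have h1 := hfs p (subset_convexHull ℝ _ hp)
  rw [map_add, map_smul, smul_eq_mul] at hsx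
  have h2 : (1 + 1 / (2 * n) : ℝ)⁻¹ * f (x - o) ≤ f (p - o) := by
    rw [inv_mul_le_iff₀ (by positivity)]; exact hle
  rw [map_sub f p o] at h2
  linarith

/-! ### The constants -/

/-- The number of angular steps that enters `kConst`. -/
noncomputable def angleSteps (ε : ℝ) (d : ℕ) : ℕ :=
  ⌈2 * π / arctan (ε / √((d : ℝ) ^ 2 - 1))⌉₊

lemma kConst_eq (ε : ℝ) (d : ℕ) :
    kConst ε d = ((angleSteps ε d : ℝ) * √(d : ℝ)) ^ (d - 1) := rfl

lemma five_le_angleSteps {ε : ℝ} (hε : 0 < ε) {d : ℕ} (hd : 2 ≤ d) : 5 ≤ angleSteps ε d := by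
  have h1 := Real.arctan_pos.2 (arctan_arg_pos hε hd)
  have h2 := Real.arctan_lt_pi_div_two (ε / √((d : ℝ) ^ 2 - 1))
  have h3 : (4 : ℝ) < 2 * π / arctan (ε / √((d : ℝ) ^ 2 - 1)) := by
    rw [lt_div_iff₀ h1]; linarith
  exact Nat.lt_ceil.2 (by exact_mod_cast h3)

lemma arctan_le_self_of_pos {x : ℝ} (hx : 0 < x) : arctan x ≤ x := by
  have := Real.lt_tan (Real.arctan_pos.2 hx) (Real.arctan_lt_pi_div_two x)
  rw [Real.tan_arctan] at this
  exact this.le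

/-- The half-angle formula turns `arctan y ≤ y` into a bound with the right behaviour for large
arguments as well. -/
lemma arctan_le_half {x : ℝ} (hx : 0 < x) : arctan x ≤ 2 * (x / (1 + √(1 + x ^ 2))) := by
  set s := √(1 + x ^ 2) with hs
  have hs2 : s ^ 2 = 1 + x ^ 2 := Real.sq_sqrt (by positivity)
  have hs0 : 0 ≤ s := Real.sqrt_nonneg _
  have hsx : x < s := by nlinarith
  have hy0 : 0 < x / (1 + s) := by positivity
  have hy1 : x / (1 + s) < 1 := by rw [div_lt_one (by positivity)]; linarith
  have h1 := Real.two_mul_arctan (x := x / (1 + s)) (by linarith) hy1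
  have h2 : 2 * (x / (1 + s)) / (1 - (x / (1 + s)) ^ 2) = x := by
    have : (1 + s) ^ 2 - x ^ 2 = 2 * (1 + s) := by nlinarith
    have h3 : 1 - (x / (1 + s)) ^ 2 = 2 / (1 + s) := by
      field_simp; linarith
    rw [h3]; field_simp
  rw [h2] at h1
  rw [← h1]
  have := arctan_le_self_of_pos hy0
  linarith

lemma le_angleSteps {ε : ℝ} (hε : 0 < ε) {d : ℕ} (hd : 2 ≤ d) :
    2 * π * √((d : ℝ) ^ 2 - 1) / ε ≤ angleSteps ε d := by
  have h0 := arctan_arg_pos hε hd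
  have h1 := Real.arctan_pos.2 h0
  have h2 := arctan_le_self_of_pos h0
  refine le_trans ?_ (Nat.le_ceil _)
  rw [show 2 * π * √((d : ℝ) ^ 2 - 1) / ε = 2 * π / (ε / √((d : ℝ) ^ 2 - 1)) by field_simp]
  gcongr

/-- A linear bound in `1 / ε`. The square root in `arctan_le_half` is replaced by its tangent at
`x = √2`, that is `ε = 4`, with rounded coefficients. -/
lemma le_angleSteps_three {ε : ℝ} (hε : 0 < ε) : 14 / ε + 2.56 ≤ angleSteps ε 3 := by
  have h0 : 0 < ε / √(((3 : ℕ) : ℝ) ^ 2 - 1) := arctan_arg_pos hε (by norm_num)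
  have h1 := Real.arctan_pos.2 h0
  have h2 := arctan_le_half h0
  refine le_trans ?_ (Nat.le_ceil _)
  rw [show (((3 : ℕ) : ℝ) ^ 2 - 1) = 8 by norm_num] at *
  set x := ε / √8 with hx
  set s := √(1 + x ^ 2) with hs
  have h8 : (2.828 : ℝ) ≤ √8 := Real.le_sqrt_of_sq_le (by norm_num)
  have hs' : 0.577 + 0.8164 * x ≤ s := by
    refine Real.le_sqrt_of_sq_le ?_
    nlinarith [sq_nonneg (x - 1.414)]
  have hεx : ε = x * √8 := by rw [hx]; field_simp
  have hpi := Real.pi_gt_d4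
  rw [le_div_iff₀ h1]
  refine (mul_le_mul_of_nonneg_left h2 (by positivity)).trans ?_
  have h3 : 14 / ε ≤ 4.951 / x := by
    rw [hεx, div_le_div_iff₀ (by positivity) h0]
    nlinarith
  calc (14 / ε + 2.56) * (2 * (x / (1 + s)))
      ≤ (4.951 / x + 2.56) * (2 * (x / (1 + s))) := by gcongr
    _ = 2 * ((4.951 + 2.56 * x) / (1 + s)) := by field_simp
    _ ≤ 2 * π := by
      have : (4.951 + 2.56 * x) / (1 + s) ≤ π := by
        rw [div_le_iff₀ (by positivity)]
        have h4 : π * (0.577 + 0.8164 * x) ≤ π * s := by gcongr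
        have h5 : 3.1415 * x ≤ π * x := by gcongr
        nlinarith
      linarith

/-- The cost of one detour through `d + 1` corners of a grid cell, in units of the side length
of the cube that the grid covers. -/
noncomputable def detourCost (ε : ℝ) (d : ℕ) : ℝ := (d + 2) * (√(d : ℝ) * granularity ε d)

lemma detourCost_eq {ε : ℝ} (hε : 0 < ε) {d : ℕ} (hd : 1 ≤ d) :
    detourCost ε d = (d + 2) * ε / (kConst ε d * (2 ^ d + 1)) := by
  have h1 := kConst_pos hε hd
  have h5 : (0 : ℝ) < √(d : ℝ) := Real.sqrt_pos.2 (by exact_mod_cast hd)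
  unfold detourCost granularity
  field_simp

lemma detourCost_pos {ε : ℝ} (hε : 0 < ε) {d : ℕ} (hd : 1 ≤ d) : 0 < detourCost ε d := by
  have h1 := kConst_pos hε hd
  rw [detourCost_eq hε hd]
  positivity

lemma detourCost_le {ε : ℝ} (hε : 0 < ε) {d : ℕ} (hd : 1 ≤ d) : detourCost ε d ≤ ε := by
  have h1 : 1 ≤ kConst ε d := by
    rcases hd.eq_or_lt with rfl | hd2
    · simp [kConst]
    · have h2 : (5 : ℝ) ≤ angleSteps ε d := by exact_mod_cast five_le_angleSteps hε hd2
      have h3 : (1 : ℝ) ≤ √(d : ℝ) := Real.one_le_sqrt.2 (by exact_mod_cast hd)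
      rw [kConst_eq]
      exact one_le_pow₀ (by nlinarith)
  have h2 : (d + 2 : ℝ) ≤ 2 ^ d + 1 := by
    have : d + 1 ≤ 2 ^ d := Nat.lt_two_pow_self
    have : (d + 1 : ℝ) ≤ 2 ^ d := by exact_mod_cast this
    linarith
  rw [detourCost_eq hε hd, div_le_iff₀ (by positivity)]
  have h3 : (1 : ℝ) * (2 ^ d + 1) ≤ kConst ε d * (2 ^ d + 1) := by gcongr
  nlinarith

/-- The parameter `n` of the planar approximation can be chosen such that enlargement and detours
together cost at most the factor `1 + ε`. For `ε < 1` take `n = ⌈1 / ε⌉`. -/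
lemma exists_cells_two {ε : ℝ} (hε : 0 < ε) : ∃ n : ℕ, 1 ≤ n ∧
    (1 + 1 / (2 * n) : ℝ) * (1 + 8 * n * detourCost ε 2 / 2) ≤ 1 + ε := by
  have h5 : (5 : ℝ) ≤ angleSteps ε 2 := by exact_mod_cast five_le_angleSteps hε le_rfl
  have hN := le_angleSteps hε (le_refl 2)
  have hk : kConst ε 2 = angleSteps ε 2 * √2 := by rw [kConst_eq]; norm_num
  have h2 : (1.414 : ℝ) ≤ √2 := Real.le_sqrt_of_sq_le (by norm_num)
  have hkpos := kConst_pos hε (d := 2) (by norm_num)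
  have hk1 : 7.07 ≤ kConst ε 2 := by rw [hk]; nlinarith
  have hk2 : 15.38 / ε ≤ kConst ε 2 := by
    have h3 : √(((2 : ℕ) : ℝ) ^ 2 - 1) = √3 := by norm_num
    rw [h3] at hN
    have h4 : (1.732 : ℝ) ≤ √3 := Real.le_sqrt_of_sq_le (by norm_num)
    have hpi := Real.pi_gt_d4
    calc 15.38 / ε ≤ 2 * π * √3 / ε * √2 := by
          rw [div_mul_eq_mul_div]
          gcongr
          calc (15.38 : ℝ) ≤ 2 * 3.1415 * 1.732 * 1.414 := by norm_num
            _ ≤ 2 * π * √3 * √2 := by gcongr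
      _ ≤ angleSteps ε 2 * √2 := by gcongr
      _ = kConst ε 2 := hk.symm
  have hc : detourCost ε 2 = 0.8 * (ε / kConst ε 2) := by
    rw [detourCost_eq hε (by norm_num)]
    field_simp
    norm_num
  rw [div_le_iff₀ hε] at hk2
  rcases le_or_gt 1 ε with h | h
  · refine ⟨1, le_rfl, ?_⟩
    have hq : ε / kConst ε 2 ≤ (ε - 0.5) / 4.8 := by
      rw [div_le_div_iff₀ hkpos (by norm_num)]
      rcases le_or_gt 1.6 ε with h' | h'
      · nlinarith
      · have : 0 < ε - 0.5 := by linarith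
        by_contra hcon
        push Not at hcon
        have h6 := mul_lt_mul_of_pos_right hcon hε
        have h7 := mul_le_mul_of_nonneg_left hk2 this.le
        nlinarith
    rw [hc]
    norm_num
    norm_num at hq
    linarith
  · refine ⟨⌈1 / ε⌉₊, Nat.one_le_ceil_iff.2 (by positivity), ?_⟩
    have hn1 := Nat.le_ceil (1 / ε)
    have hn2 := Nat.ceil_lt_add_one (show 0 ≤ 1 / ε by positivity)
    set n : ℝ := (⌈1 / ε⌉₊ : ℝ) with hn
    rw [div_le_iff₀ hε] at hn1
    have hn3 : n * ε < 1 + ε := by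
      have := mul_lt_mul_of_pos_right hn2 hε
      rwa [add_mul, div_mul_cancel₀ _ hε.ne', one_mul] at this
    have hnpos : 0 < n := by
      by_contra hcon; push Not at hcon; nlinarith
    have hq : ε / kConst ε 2 ≤ ε ^ 2 / 15.38 := by
      rw [div_le_div_iff₀ hkpos (by norm_num)]; nlinarith
    have hq' : 8 * n * detourCost ε 2 / 2 ≤ 3.2 * n * (ε ^ 2 / 15.38) := by
      rw [hc]
      nlinarith [mul_le_mul_of_nonneg_left hq hnpos.le]
    refine (mul_le_mul_of_nonneg_left (add_le_add_right hq' 1) (by positivity)).trans ?_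
    have hz : ∀ z : ℝ, 1 ≤ z → z < 1 + ε →
        1 + (6.4 * z ^ 2 + 3.2 * z * ε) / 15.38 ≤ 2 * z := by
      intro z h1 h2
      have h3 : 0 ≤ (z - 1) * (2 - z) := mul_nonneg (by linarith) (by linarith)
      have h4 : z * ε ≤ z := by nlinarith
      rw [← sub_nonneg]
      have h5 : 0 ≤ (z - 1) * (2 - z) * (6.4 / 15.38) + (z - z * ε) * (3.2 / 15.38) := by
        have : 0 ≤ z - z * ε := by linarith
        positivity
      norm_num at h5 ⊢
      nlinarith
    have : 2 * n * ((1 + 1 / (2 * n)) * (1 + 3.2 * n * (ε ^ 2 / 15.38))) ≤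
        2 * n * (1 + ε) := by
      have e : 2 * n * ((1 + 1 / (2 * n)) * (1 + 3.2 * n * (ε ^ 2 / 15.38))) =
        2 * n + (1 + (6.4 * (n * ε) ^ 2 + 3.2 * (n * ε) * ε) / 15.38) := by field_simp; ring
      rw [e]; linarith [hz (n * ε) hn1 hn3]
    exact le_of_mul_le_mul_left this (by positivity)

/-- The analogue of `exists_cells_two` for the radial approximation in dimension `3`. This is the
tightest case; it needs a bound on the number of angular steps that is good both for small and for
large `ε`. For `ε < 5` take `n = ⌈10 / ε⌉`. -/
lemma exists_cells_three {ε : ℝ} (hε : 0 < ε) : ∃ n : ℕ, 1 ≤ n ∧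
    (1 + 2 * 3 / n : ℝ) * (1 + (2 * 3 * n ^ 2 + 2 * 3) * detourCost ε 3 / 2) ≤ 1 + ε := by
  have h5 : (5 : ℝ) ≤ angleSteps ε 3 := by exact_mod_cast five_le_angleSteps hε (by norm_num)
  have hN := le_angleSteps_three hε
  have hk : kConst ε 3 = 3 * (angleSteps ε 3 : ℝ) ^ 2 := by
    rw [kConst_eq]
    norm_num [mul_pow]
    ring
  have hc : detourCost ε 3 = 5 / 27 * (ε / (angleSteps ε 3 : ℝ) ^ 2) := by
    rw [detourCost_eq hε (by norm_num), hk]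
    field_simp
    norm_num
  rw [hc]
  rcases le_or_gt 5 ε with h | h
  · refine ⟨2, by norm_num, ?_⟩
    have hq : ε / (angleSteps ε 3 : ℝ) ^ 2 ≤ (ε - 3) * 9 / 100 := by
      rw [div_le_div_iff₀ (by positivity) (by norm_num)]
      rcases le_or_gt 5.4 ε with h' | h'
      · have h6 : (25 : ℝ) ≤ (angleSteps ε 3 : ℝ) ^ 2 := by nlinarith
        have := mul_le_mul_of_nonneg_left h6 (show 0 ≤ ε - 3 by linarith)
        linarith
      · have h6 : (5 : ℝ) < angleSteps ε 3 := by
          have : 14 / 5.4 ≤ 14 / ε := by gcongr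
          norm_num at this
          linarith
        have h7 : (6 : ℝ) ≤ angleSteps ε 3 := by
          have : 5 < angleSteps ε 3 := by exact_mod_cast h6
          exact_mod_cast this
        nlinarith
    norm_num
    linarith
  · refine ⟨⌈10 / ε⌉₊, Nat.one_le_ceil_iff.2 (by positivity), ?_⟩
    have hn1 := Nat.le_ceil (10 / ε)
    have hn2 := Nat.ceil_lt_add_one (show 0 ≤ 10 / ε by positivity)
    set n : ℝ := (⌈10 / ε⌉₊ : ℝ) with hn
    rw [div_le_iff₀ hε] at hn1
    have hn3 : n * ε < 10 + ε := by
      have := mul_lt_mul_of_pos_right hn2 hε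
      rwa [add_mul, div_mul_cancel₀ _ hε.ne', one_mul] at this
    have hnpos : 0 < n := by
      by_contra hcon; push Not at hcon; nlinarith
    set B := 14 + 2.5 * ε with hB
    have hBN : B ≤ angleSteps ε 3 * ε := by
      have := mul_le_mul_of_nonneg_right hN hε.le
      rw [add_mul, div_mul_cancel₀ _ hε.ne'] at this
      rw [hB]; linarith
    have hBpos : 0 < B := by rw [hB]; positivity
    have hq : ε / (angleSteps ε 3 : ℝ) ^ 2 ≤ ε ^ 3 / B ^ 2 := by
      rw [div_le_div_iff₀ (by positivity) (by positivity)]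
      have : B ^ 2 ≤ (angleSteps ε 3 * ε) ^ 2 := by gcongr
      nlinarith
    have hz : 5 / 9 * (n * ε + 6 * ε) * ((n * ε) ^ 2 + ε ^ 2) ≤ (n * ε - 6) * B ^ 2 := by
      set z := n * ε
      obtain ⟨τ, hτ0, hτ1, hτ⟩ : ∃ τ, 0 ≤ τ ∧ τ ≤ ε ∧ z = 10 + τ :=
        ⟨z - 10, by linarith, by linarith, by ring⟩
      have h1 : τ ^ 2 ≤ ε * τ := by nlinarith
      have h2 : τ ^ 3 ≤ ε ^ 2 * τ := by
        have : τ ^ 2 ≤ ε ^ 2 := by gcongr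
        nlinarith
      have h3 : (30 + 6 * ε) * τ ^ 2 ≤ (30 + 6 * ε) * (ε * τ) := by gcongr
      -- after these bounds the difference of the two sides is linear in `τ`
      have h4 : 0 ≤ τ * (B ^ 2 - 5 / 9 * (300 + 150 * ε + 8 * ε ^ 2)) := by
        refine mul_nonneg hτ0 ?_
        rw [hB]; nlinarith [sq_nonneg (ε - 3.7)]
      have h5 : 0 ≤ 4 * B ^ 2 - 5 / 9 * ((10 + 6 * ε) * (100 + ε ^ 2)) := by
        rw [hB]
        nlinarith [mul_nonneg (sq_nonneg ε) (show 0 ≤ 5 - ε by linarith), sq_nonneg (ε - 5)]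
      have h6 : (10 + τ + 6 * ε) * ((10 + τ) ^ 2 + ε ^ 2) =
          τ ^ 3 + (30 + 6 * ε) * τ ^ 2 + (100 + ε ^ 2 + 20 * (10 + 6 * ε)) * τ +
            (10 + 6 * ε) * (100 + ε ^ 2) := by ring
      rw [hτ, mul_assoc, h6]
      linarith
    calc (1 + 2 * 3 / n) * (1 + (2 * 3 * n ^ 2 + 2 * 3) *
          (5 / 27 * (ε / (angleSteps ε 3 : ℝ) ^ 2)) / 2)
        ≤ (1 + 2 * 3 / n) * (1 + (2 * 3 * n ^ 2 + 2 * 3) * (5 / 27 * (ε ^ 3 / B ^ 2)) / 2) := by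
          gcongr
      _ = 1 + (6 * B ^ 2 + 5 / 9 * (n * ε + 6 * ε) * ((n * ε) ^ 2 + ε ^ 2)) / (n * B ^ 2) := by
          field_simp; ring
      _ ≤ 1 + ε := by
          gcongr
          rw [div_le_iff₀ (by positivity)]
          linarith

lemma growth_five {d : ℕ} (hd : 4 ≤ d) : (5.7 : ℝ) * (1 + 2 * d) ≤ 5 ^ (d - 1) := by
  induction d, hd using Nat.le_induction with
  | base => norm_num
  | succ d hd ih =>
    have : (5 : ℝ) ^ (d + 1 - 1) = 5 ^ (d - 1) * 5 := by
      rw [← pow_succ]; congr 1; omega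
    rw [this]; push_cast
    have : (4 : ℝ) ≤ d := by exact_mod_cast hd
    linarith

lemma growth_two {d : ℕ} (hd : 4 ≤ d) : (2.95 : ℝ) * (1 + 2 * d / 3) ≤ 2.4 ^ (d - 1) := by
  induction d, hd using Nat.le_induction with
  | base => norm_num
  | succ d hd ih =>
    have : (2.4 : ℝ) ^ (d + 1 - 1) = 2.4 ^ (d - 1) * 2.4 := by
      rw [← pow_succ]; congr 1; omega
    rw [this]; push_cast
    have : (4 : ℝ) ≤ d := by exact_mod_cast hd
    linarith

lemma mul_add_two_le_two_pow {d : ℕ} (hd : 4 ≤ d) :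
    17 * ((d : ℝ) * (d + 2)) ≤ 24 * (2 ^ d + 1) := by
  induction d, hd using Nat.le_induction with
  | base => norm_num
  | succ d hd ih =>
    have : (4 : ℝ) ≤ d := by exact_mod_cast hd
    rw [pow_succ]; push_cast
    nlinarith

/-- The number of angular steps, compared with the number `n = ⌈4 d / ε⌉` of cells per
coordinate. -/
lemma mul_ceil_le_angleSteps {ε : ℝ} (hε : 0 < ε) {d : ℕ} (hd : 4 ≤ d) :
    1.2 * (⌈4 * d / ε⌉₊ : ℝ) ≤ angleSteps ε d := by
  have hd' : (4 : ℝ) ≤ d := by exact_mod_cast hd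
  set n := ⌈4 * d / ε⌉₊ with hn
  have h5 : (5 : ℝ) ≤ angleSteps ε d := by exact_mod_cast five_le_angleSteps hε (by omega)
  rcases le_or_gt n 4 with h | h
  · have : (n : ℝ) ≤ 4 := by exact_mod_cast h
    linarith
  · have h6 : (5 : ℝ) ≤ n := by exact_mod_cast h
    have hlt : (n : ℝ) < 4 * d / ε + 1 := Nat.ceil_lt_add_one (by positivity)
    have hN := le_angleSteps hε (show 2 ≤ d by omega)
    have hs : 0.968 * d ≤ √((d : ℝ) ^ 2 - 1) := Real.le_sqrt_of_sq_le (by nlinarith)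
    have hpi := Real.pi_gt_d2
    have h7 : 1.519 * (4 * d / ε) ≤ angleSteps ε d := by
      refine le_trans ?_ hN
      rw [mul_div_assoc', div_le_div_iff_of_pos_right hε]
      calc 1.519 * (4 * (d : ℝ)) ≤ 2 * 3.14 * (0.968 * d) := by linarith
        _ ≤ 2 * π * √((d : ℝ) ^ 2 - 1) := by gcongr
    linarith

/-- The analogue of `exists_cells_two` for the radial approximation in dimension `d ≥ 4`: with
`n = ⌈4 d / ε⌉` the enlargement and the detours take at most half of the allowance each. -/
lemma exists_cells_ge_four {ε : ℝ} (hε : 0 < ε) {d : ℕ} (hd : 4 ≤ d) : ∃ n : ℕ, 1 ≤ n ∧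
    (1 + 2 * d / n : ℝ) * (1 + (2 * d * n ^ (d - 1) + 2 * d) * detourCost ε d / 2) ≤ 1 + ε := by
  have hd' : (4 : ℝ) ≤ d := by exact_mod_cast hd
  refine ⟨⌈4 * d / ε⌉₊, Nat.one_le_ceil_iff.2 (by positivity), ?_⟩
  have hNn := mul_ceil_le_angleSteps hε hd
  have hle : 4 * d / ε ≤ (⌈4 * d / ε⌉₊ : ℝ) := Nat.le_ceil _
  have hn1 : 1 ≤ ⌈4 * d / ε⌉₊ := Nat.one_le_ceil_iff.2 (by positivity)
  set n := ⌈4 * d / ε⌉₊ with hn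
  have hn1' : (1 : ℝ) ≤ n := by exact_mod_cast hn1
  have hkpos := kConst_pos hε (d := d) (by omega)
  have h5 : (5 : ℝ) ≤ angleSteps ε d := by exact_mod_cast five_le_angleSteps hε (by omega)
  have hsd : (2 : ℝ) ≤ √(d : ℝ) := Real.le_sqrt_of_sq_le (by linarith)
  -- the number of cells per face is small compared with `kConst`
  have hk : 48 / 17 * (1 + 2 * d / n) * ((n : ℝ) ^ (d - 1) + 1) ≤ kConst ε d := by
    rw [kConst_eq]
    rcases le_or_gt n 2 with h | h
    · have h2 : (n : ℝ) ≤ 2 := by exact_mod_cast h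
      have e1 : 5 * (n : ℝ) ≤ angleSteps ε d * √(d : ℝ) := by nlinarith
      have e2 : (5 : ℝ) ^ (d - 1) * n ^ (d - 1) ≤ (angleSteps ε d * √(d : ℝ)) ^ (d - 1) := by
        rw [← mul_pow]; gcongr
      have e3 : (1 : ℝ) ≤ (n : ℝ) ^ (d - 1) := one_le_pow₀ hn1'
      have e4 : (2 * d / n : ℝ) ≤ 2 * d := div_le_self (by positivity) hn1'
      calc 48 / 17 * (1 + 2 * d / n) * ((n : ℝ) ^ (d - 1) + 1)
          ≤ 48 / 17 * (1 + 2 * d) * ((n : ℝ) ^ (d - 1) + n ^ (d - 1)) := by gcongr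
        _ = 96 / 17 * (1 + 2 * d) * n ^ (d - 1) := by ring
        _ ≤ 5.7 * (1 + 2 * d) * n ^ (d - 1) := by gcongr; norm_num
        _ ≤ 5 ^ (d - 1) * n ^ (d - 1) := by gcongr; exact growth_five hd
        _ ≤ _ := e2
    · have h3 : (3 : ℝ) ≤ n := by exact_mod_cast h
      have e1 : 2.4 * (n : ℝ) ≤ angleSteps ε d * √(d : ℝ) := by nlinarith
      have e2 : (2.4 : ℝ) ^ (d - 1) * n ^ (d - 1) ≤ (angleSteps ε d * √(d : ℝ)) ^ (d - 1) := by
        rw [← mul_pow]; gcongr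
      have e3 : (27 : ℝ) ≤ (n : ℝ) ^ (d - 1) := by
        calc (27 : ℝ) = 3 ^ 3 := by norm_num
          _ ≤ (n : ℝ) ^ 3 := by gcongr
          _ ≤ (n : ℝ) ^ (d - 1) := pow_le_pow_right₀ hn1' (by omega)
      have e4 : (2 * d / n : ℝ) ≤ 2 * d / 3 := by gcongr
      calc 48 / 17 * (1 + 2 * d / n) * ((n : ℝ) ^ (d - 1) + 1)
          ≤ 48 / 17 * (1 + 2 * d / 3) * ((n : ℝ) ^ (d - 1) + n ^ (d - 1) / 27) := by
            gcongr; linarith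
        _ = 48 / 17 * (28 / 27) * (1 + 2 * d / 3) * n ^ (d - 1) := by ring
        _ ≤ 2.95 * (1 + 2 * d / 3) * n ^ (d - 1) := by gcongr; norm_num
        _ ≤ 2.4 ^ (d - 1) * n ^ (d - 1) := by gcongr; exact growth_two hd
        _ ≤ _ := e2
  have hδ : (2 * d / n : ℝ) ≤ ε / 2 := by
    rw [div_le_iff₀ hε] at hle
    rw [div_le_iff₀ (by linarith)]
    linarith
  have hc : d * detourCost ε d ≤ 24 / 17 * ε / kConst ε d := by
    rw [detourCost_eq hε (by omega), mul_div_assoc', div_le_div_iff₀ (by positivity) hkpos]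
    have h1 := mul_add_two_le_two_pow hd
    have h2 : 0 ≤ ε * kConst ε d := by positivity
    have := mul_le_mul_of_nonneg_left h1 h2
    linarith
  have hA : (1 + 2 * d / n : ℝ) * (((n : ℝ) ^ (d - 1) + 1) * (d * detourCost ε d)) ≤ ε / 2 := by
    calc (1 + 2 * d / n : ℝ) * (((n : ℝ) ^ (d - 1) + 1) * (d * detourCost ε d))
        ≤ (1 + 2 * d / n : ℝ) * (((n : ℝ) ^ (d - 1) + 1) * (24 / 17 * ε / kConst ε d)) := by
          gcongr
      _ = (48 / 17 * (1 + 2 * d / n) * ((n : ℝ) ^ (d - 1) + 1)) * (ε / (2 * kConst ε d)) := by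
          field_simp; ring
      _ ≤ kConst ε d * (ε / (2 * kConst ε d)) := by gcongr
      _ = ε / 2 := by field_simp
  calc (1 + 2 * d / n : ℝ) * (1 + (2 * d * n ^ (d - 1) + 2 * d) * detourCost ε d / 2)
      = 1 + 2 * d / n + (1 + 2 * d / n : ℝ) * (((n : ℝ) ^ (d - 1) + 1) * (d * detourCost ε d)) := by
        ring
    _ ≤ 1 + ε := by linarith

/-! ### Few points of a finite set that nearly span its hull -/

/-- Transport of an approximation in adapted coordinates back to the ambient space. -/
lemma exists_approximation_of_coordinates {F : Type*} [AddCommGroup F] [Module ℝ F]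
    (W : Finset F) {w₀ : F} (hw₀ : w₀ ∈ W) {r : ℕ} (a b : Fin r → F) (f : F →ₗ[ℝ] (Fin r → ℝ))
    (hexp : ∀ w ∈ W, ∀ w' ∈ W, w - w' = ∑ i, (f w i - f w' i) • (a i - b i)) (δ : ℝ) (m : ℕ)
    (h : ∀ A : Finset (Fin r → ℝ), (∀ y, y ∈ A ↔ ∃ w ∈ W, f w = y) →
      ∃ S ⊆ A, S.card ≤ m ∧ ∃ o, ∀ x ∈ A,
        o + (1 + δ)⁻¹ • (x - o) ∈ convexHull ℝ (S : Set (Fin r → ℝ))) :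
    ∃ S ⊆ W, S.card ≤ m ∧ ∃ o, ∀ x ∈ W,
      o + (1 + δ)⁻¹ • (x - o) ∈ convexHull ℝ (S : Set F) := by
  classical
  obtain ⟨S, hSA, hSm, o, ho⟩ := h (W.image f) (fun y => by simp)
  let L : (Fin r → ℝ) →ₗ[ℝ] F := Fintype.linearCombination ℝ fun i => a i - b i
  let Ψ : (Fin r → ℝ) →ᵃ[ℝ] F := L.toAffineMap + AffineMap.const ℝ _ (w₀ - L (f w₀))
  have hΨ : ∀ w ∈ W, Ψ (f w) = w := by
    intro w hw
    have h1 : L (f w) - L (f w₀) = w - w₀ := by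
      rw [← map_sub, hexp w hw w₀ hw₀]
      simp [L, Fintype.linearCombination_apply]
    have h2 : Ψ (f w) = L (f w) + (w₀ - L (f w₀)) := rfl
    rw [h2, add_sub_left_comm, h1, add_sub_cancel]
  refine ⟨S.image Ψ, ?_, Finset.card_image_le.trans hSm, Ψ o, fun x hx => ?_⟩
  · intro p hp
    obtain ⟨y, hy, rfl⟩ := Finset.mem_image.1 hp
    obtain ⟨w, hw, rfl⟩ := Finset.mem_image.1 (hSA hy)
    rwa [hΨ w hw]
  · rw [Finset.coe_image, ← AffineMap.image_convexHull]
    refine ⟨_, ho (f x) (Finset.mem_image_of_mem f hx), ?_⟩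
    conv_rhs => rw [← hΨ x hx]
    have h2 : ∀ y, Ψ y = L y + (w₀ - L (f w₀)) := fun _ => rfl
    simp only [h2, map_add, map_smul, map_sub]
    module

/-- Every finite set of points contains a subset whose hull, enlarged by a factor `1 + δ`,
covers it, and that is so small that detours at all its points are affordable. -/
lemma exists_cheap_approximation {ε : ℝ} (hε : 0 < ε) {d : ℕ} (hd : 1 ≤ d) (W : Finset (E d))
    (hW : W.Nonempty) : ∃ S ⊆ W, ∃ (o : E d) (δ : ℝ), 0 ≤ δ ∧
      (∀ x ∈ W, o + (1 + δ)⁻¹ • (x - o) ∈ convexHull ℝ (S : Set (E d))) ∧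
      (1 + δ) * (1 + S.card * detourCost ε d / 2) ≤ 1 + ε := by
  classical
  obtain ⟨w₀, hw₀⟩ := hW
  obtain ⟨r, hr, a, b, f, ha, hb, hab, hwid, hexp⟩ := exists_extremal_coordinates W
  rw [finrank_euclideanSpace_fin] at hr
  have hcpos := detourCost_pos hε hd
  have hcle := detourCost_le hε hd
  have hcost : ∀ (S : Finset (E d)) (δ M B : ℝ), 0 ≤ δ → (S.card : ℝ) ≤ M → δ ≤ B →
      (1 + B) * (1 + M * detourCost ε d / 2) ≤ 1 + ε →
      (1 + δ) * (1 + S.card * detourCost ε d / 2) ≤ 1 + ε := by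
    intro S δ M B hδ hS hB h
    have hB0 : 0 ≤ 1 + B := by linarith
    refine le_trans ?_ h
    gcongr
  match r, hr, a, b, f, ha, hb, hab, hwid, hexp with
  | 0, hr, a, b, f, ha, hb, hab, hwid, hexp =>
    refine ⟨{w₀}, by simpa using hw₀, w₀, 0, le_rfl, fun x hx => ?_, ?_⟩
    · have h1 := hexp x hx w₀ hw₀
      rw [Finset.univ_eq_empty, Finset.sum_empty] at h1
      rw [h1]; simp
    · refine hcost _ 0 2 0 le_rfl (by simp) le_rfl ?_
      linarith
  | 1, hr, a, b, f, ha, hb, hab, hwid, hexp =>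
    refine ⟨{a 0, b 0}, ?_, b 0, 0, le_rfl, fun x hx => ?_, ?_⟩
    · intro p hp
      simp only [Finset.mem_insert, Finset.mem_singleton] at hp
      rcases hp with rfl | rfl
      exacts [ha 0, hb 0]
    · have h1 := hexp x hx (b 0) (hb 0)
      have h2 := hwid x hx (b 0) (hb 0) 0
      have h3 := hwid (a 0) (ha 0) x hx 0
      have h4 : f (a 0) 0 - f (b 0) 0 = 1 := by simpa using congrFun (hab 0) 0
      rw [Fin.sum_univ_one] at h1
      rw [h1, add_zero, inv_one, one_smul]
      refine (convex_convexHull ℝ _).add_smul_sub_mem (subset_convexHull ℝ _ (by simp))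
        (subset_convexHull ℝ _ (by simp)) ⟨by linarith, h2⟩
    · refine hcost _ 0 2 0 le_rfl ?_ le_rfl (by linarith)
      exact_mod_cast Finset.card_le_two
  | q + 2, hr, a, b, f, ha, hb, hab, hwid, hexp =>
    have hmem : ∀ A : Finset (Fin (q + 2) → ℝ), (∀ y, y ∈ A ↔ ∃ w ∈ W, f w = y) →
        (∀ i, f (a i) ∈ A) ∧ (∀ i, f (b i) ∈ A) ∧ ∀ x ∈ A, ∀ y ∈ A, ∀ i, x i - y i ≤ 1 := by
      intro A hA
      refine ⟨fun i => (hA _).2 ⟨_, ha i, rfl⟩, fun i => (hA _).2 ⟨_, hb i, rfl⟩, ?_⟩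
      intro x hx y hy i
      obtain ⟨w, hw, rfl⟩ := (hA x).1 hx
      obtain ⟨w', hw', rfl⟩ := (hA y).1 hy
      exact hwid w hw w' hw' i
    rcases (show 2 ≤ d by omega).eq_or_lt with rfl | hd3
    · obtain rfl : q = 0 := by omega
      obtain ⟨n, hn, hle⟩ := exists_cells_two hε
      obtain ⟨S, hSW, hSc, o, ho⟩ := exists_approximation_of_coordinates W hw₀ a b f hexp
        (1 / (2 * n)) (8 * n) (fun A hA => by
          obtain ⟨h1, h2, h3⟩ := hmem A hA
          exact exists_planar_approximation A (fun i => f (a i)) (fun i => f (b i)) h1 h2 hab h3 hn)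
      refine ⟨S, hSW, o, 1 / (2 * n), by positivity, ho, ?_⟩
      exact hcost S _ (8 * n) _ (by positivity) (by exact_mod_cast hSc) le_rfl hle
    · obtain ⟨n, hn, hle⟩ : ∃ n : ℕ, 1 ≤ n ∧ (1 + 2 * d / n : ℝ) *
          (1 + (2 * d * n ^ (d - 1) + 2 * d) * detourCost ε d / 2) ≤ 1 + ε := by
        rcases (show 3 ≤ d by omega).eq_or_lt with rfl | hd4
        · exact_mod_cast exists_cells_three hε
        · exact exists_cells_ge_four hε hd4
      obtain ⟨S, hSW, hSc, o, ho⟩ := exists_approximation_of_coordinates W hw₀ a b f hexp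
        (2 * ((q + 1 : ℕ) + 1) / n) (2 * (q + 1 + 1) * n ^ (q + 1) + 2 * (q + 1 + 1))
        (fun A hA => by
          obtain ⟨h1, h2, h3⟩ := hmem A hA
          exact exists_radial_approximation A (fun i => f (a i)) (fun i => f (b i)) h1 h2 hab h3 hn)
      refine ⟨S, hSW, o, _, by positivity, ho, ?_⟩
      have hqd : ((q + 1 : ℕ) + 1 : ℝ) ≤ d := by exact_mod_cast hr
      have hn' : (1 : ℝ) ≤ n := by exact_mod_cast hn
      refine hcost S _ _ _ (by positivity) ?_ (by gcongr) hle
      calc (S.card : ℝ) ≤ 2 * ((q + 1 : ℕ) + 1) * n ^ (q + 1) + 2 * ((q + 1 : ℕ) + 1) := by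
            exact_mod_cast hSc
        _ ≤ 2 * d * n ^ (d - 1) + 2 * d := by
            gcongr
            · omega

/-! ### Rounding to the grid -/

lemma dist_le_of_forall_abs_le {d : ℕ} {x y : E d} {g : ℝ} (hg : 0 ≤ g)
    (h : ∀ i, |x i - y i| ≤ g) : dist x y ≤ √(d : ℝ) * g := by
  rw [EuclideanSpace.dist_eq]
  refine Real.sqrt_le_iff.2 ⟨by positivity, ?_⟩
  rw [mul_pow, Real.sq_sqrt (by positivity)]
  calc ∑ i, dist (x i) (y i) ^ 2 ≤ ∑ _i : Fin d, g ^ 2 := by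
        refine Finset.sum_le_sum fun i _ => ?_
        rw [Real.dist_eq]
        have := h i
        gcongr
    _ = d * g ^ 2 := by simp

lemma mem_convexHull_box_corners {d : ℕ} (lo hi : Fin d → ℝ) {y : E d}
    (hy : ∀ i, lo i ≤ y i ∧ y i ≤ hi i) :
    y ∈ convexHull ℝ {p : E d | ∀ i, p i = lo i ∨ p i = hi i} := by
  let e := (WithLp.linearEquiv 2 ℝ (Fin d → ℝ)).symm
  have h1 : (fun i => y i) ∈ convexHull ℝ
      (Set.univ.pi fun i : Fin d => ({lo i, hi i} : Set ℝ)) := by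
    rw [convexHull_pi]
    intro i _
    dsimp only
    rw [convexHull_pair, segment_eq_Icc ((hy i).1.trans (hy i).2)]
    exact hy i
  have h2 := Set.mem_image_of_mem e h1
  rw [← LinearEquiv.coe_coe, LinearMap.image_convexHull] at h2
  refine convexHull_mono ?_ h2
  rintro _ ⟨p, hp, rfl⟩ i
  exact hp i (Set.mem_univ i)

/-- A point of the unit cube lies in the hull of at most `d + 1` corners of a grid cell that
contains it. -/
lemma exists_grid_simplex {ε : ℝ} (hε : 0 < ε) {d : ℕ} (hd : 1 ≤ d) {y : E d}
    (h0 : ∀ i, 0 ≤ y i) (h1 : ∀ i, y i ≤ 1) :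
    ∃ V : Finset (E d), V.card ≤ d + 1 ∧ (V : Set (E d)) ⊆ gridPoints ε d ∧
      y ∈ convexHull ℝ (V : Set (E d)) ∧
      (∀ p ∈ V, dist y p ≤ √(d : ℝ) * granularity ε d) ∧
      ∀ p ∈ V, ∀ p' ∈ V, dist p p' ≤ √(d : ℝ) * granularity ε d := by
  have hg := granularity_pos hε hd
  set g := granularity ε d with hgdef
  set M := ⌈1 / g⌉₊ with hM
  have hM1 : 1 ≤ M := Nat.one_le_ceil_iff.2 (by positivity)
  have hMpos : (0 : ℝ) < M := by exact_mod_cast hM1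
  have hMg : 1 ≤ M * g := by
    have := Nat.le_ceil (1 / g)
    rwa [div_le_iff₀ hg] at this
  have hcell : ∀ i, ∃ z : Fin M, g * z ≤ y i ∧ y i ≤ g * (z + 1) := by
    intro i
    obtain ⟨z, hz1, hz2⟩ := exists_interval_index hM1 (u := y i / (M * g))
      (div_nonneg (h0 i) (by positivity)) ((div_le_one (by positivity)).2 ((h1 i).trans hMg))
    refine ⟨z, ?_, ?_⟩
    · rw [div_le_div_iff₀ hMpos (by positivity)] at hz1
      have : (M : ℝ) * (g * z) ≤ M * y i := by linarith
      exact le_of_mul_le_mul_left this hMpos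
    · rw [div_le_div_iff₀ (by positivity) hMpos] at hz2
      have : (M : ℝ) * y i ≤ M * (g * (z + 1)) := by linarith
      exact le_of_mul_le_mul_left this hMpos
  choose z hz using hcell
  have hy := mem_convexHull_box_corners _ _ hz
  rw [convexHull_eq_union] at hy
  simp only [Set.mem_iUnion] at hy
  obtain ⟨V, hV, hVi, hyV⟩ := hy
  have hlo : ∀ p ∈ V, ∀ i, g * z i ≤ p i ∧ p i ≤ g * (z i + 1) := by
    intro p hp i
    rcases hV hp i with h | h <;> rw [h] <;> constructor <;> nlinarith
  refine ⟨V, ?_, ?_, hyV, ?_, ?_⟩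
  · have h2 := hVi.card_le_finrank_succ
    rw [Fintype.card_coe] at h2
    refine h2.trans (Nat.add_le_add_right ?_ 1)
    exact (Submodule.finrank_le _).trans finrank_euclideanSpace_fin.le
  · intro p hp
    have h2 : ∀ i, ∃ k : ℕ, k ≤ M ∧ p i = g * k := by
      intro i
      rcases hV hp i with h | h
      · exact ⟨z i, (z i).2.le, h⟩
      · exact ⟨z i + 1, (z i).2, by rw [h]; push_cast; ring⟩
    choose k hk1 hk2 using h2
    exact ⟨k, hk1, hk2⟩
  · intro p hp
    refine dist_le_of_forall_abs_le hg.le fun i => ?_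
    have := hlo p hp i
    have := hz i
    rw [abs_le]; constructor <;> linarith
  · intro p hp p' hp'
    refine dist_le_of_forall_abs_le hg.le fun i => ?_
    have := hlo p hp i
    have := hlo p' hp' i
    rw [abs_le]; constructor <;> linarith

/-- Enlarging an approximation of the corners of a tour and rounding it to a grid gives a
polytope that contains the tour, and a tour through its vertices: the enlarged tour with detours.
The grid is scaled such that it covers a cube whose side is half the length of the enlarged tour. -/
lemma exists_rounded_polytope {ε : ℝ} (hε : 0 < ε) {d : ℕ} (hd : 1 ≤ d) (T : Tour d)
    (hT : 0 < T.length) (S : Finset (E d)) (hS : (S : Set (E d)) ⊆ Set.range T.pt) (o : E d)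
    {δ : ℝ} (hδ : 0 ≤ δ)
    (happ : ∀ i, o + (1 + δ)⁻¹ • (T.pt i - o) ∈ convexHull ℝ (S : Set (E d))) :
    ∃ V : Finset (E d), V.Nonempty ∧ convexHull ℝ (V : Set (E d)) ∈ polytopes (baseSet ε d) ∧
      (∀ i, T.pt i ∈ convexHull ℝ (V : Set (E d))) ∧
      ∃ T' : Tour d, (V : Set (E d)) ⊆ T'.carrier ∧
        T'.length ≤ (1 + δ) * (1 + S.card * detourCost ε d / 2) * T.length := by
  classical
  have hδ' : 0 < 1 + δ := by positivity
  let H : E d →ᵃ[ℝ] E d := AffineMap.homothety o (1 + δ)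
  have hH : ∀ x, H x = (1 + δ) • (x - o) + o := fun x => rfl
  have hHd : ∀ x y, dist (H x) (H y) = (1 + δ) * dist x y := by
    intro x y
    rw [hH, hH, dist_add_right, dist_smul₀, dist_sub_right, Real.norm_of_nonneg hδ'.le]
  let T₁ : Tour d := ⟨T.n, fun i => H (T.pt i)⟩
  have hT₁ : T₁.length = (1 + δ) * T.length := by
    simp only [Tour.length, T₁, hHd, Finset.mul_sum]
  set r := T₁.length / 2 with hr
  have hrpos : 0 < r := by rw [hr, hT₁]; positivity
  -- the corner of the cube
  have hmin : ∀ i : Fin d, ∃ k, ∀ j, T₁.pt k i ≤ T₁.pt j i := fun i =>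
    Finite.exists_min fun j => T₁.pt j i
  choose k hk using hmin
  let t : E d := WithLp.toLp 2 fun i => T₁.pt (k i) i
  have hcube : ∀ j i, 0 ≤ (r⁻¹ • (T₁.pt j - t)) i ∧ (r⁻¹ • (T₁.pt j - t)) i ≤ 1 := by
    intro j i
    have e : (r⁻¹ • (T₁.pt j - t)) i = r⁻¹ * (T₁.pt j i - T₁.pt (k i) i) := rfl
    have h1 := hk i j
    have h2 : T₁.pt j i - T₁.pt (k i) i ≤ r := by
      have h3 := T₁.two_mul_dist_le_length (T₁.pt_mem_carrier j) (T₁.pt_mem_carrier (k i))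
      have h4 : ‖(T₁.pt j - T₁.pt (k i)) i‖ ≤ ‖T₁.pt j - T₁.pt (k i)‖ := PiLp.norm_apply_le _ i
      rw [← dist_eq_norm] at h4
      have h5 := le_abs_self (T₁.pt j i - T₁.pt (k i) i)
      have h6 : |T₁.pt j i - T₁.pt (k i) i| ≤ dist (T₁.pt j) (T₁.pt (k i)) := h4
      rw [hr]; linarith
    rw [e]
    refine ⟨mul_nonneg (by positivity) (by linarith), ?_⟩
    rw [inv_mul_le_iff₀ hrpos]; linarith
  have hsimp : ∀ s : E d, ∃ V : Finset (E d), s ∈ S → V.card ≤ d + 1 ∧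
      (V : Set (E d)) ⊆ gridPoints ε d ∧
      r⁻¹ • (H s - t) ∈ convexHull ℝ (V : Set (E d)) ∧
      (∀ p ∈ V, dist (r⁻¹ • (H s - t)) p ≤ √(d : ℝ) * granularity ε d) ∧
      ∀ p ∈ V, ∀ p' ∈ V, dist p p' ≤ √(d : ℝ) * granularity ε d := by
    intro s
    by_cases hs : s ∈ S
    · obtain ⟨j, rfl⟩ := hS hs
      obtain ⟨V, hV⟩ := exists_grid_simplex hε hd (fun i => (hcube j i).1)
        (fun i => (hcube j i).2)
      exact ⟨V, fun _ => hV⟩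
    · exact ⟨∅, fun h => absurd h hs⟩
  choose V hV using hsimp
  let Φ : E d →ᵃ[ℝ] E d := r • AffineMap.id ℝ (E d) + AffineMap.const ℝ (E d) t
  have hΦ : ∀ x, Φ x = t + r • x := fun x => by simp [Φ, add_comm]
  have hΦi : ∀ x, Φ (r⁻¹ • (x - t)) = x := fun x => by
    rw [hΦ, smul_smul, mul_inv_cancel₀ hrpos.ne', one_smul, add_sub_cancel]
  have hΦd : ∀ x y, dist (Φ x) (Φ y) = r * dist x y := by
    intro x y
    rw [hΦ, hΦ, dist_add_left, dist_smul₀, Real.norm_of_nonneg hrpos.le]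
  set R := r * (√(d : ℝ) * granularity ε d) with hR
  have hg := granularity_pos hε hd
  -- the enlarged tour with a detour at each point of `H '' S`
  set l : List (E d) := T₁.pt 0 :: List.ofFn fun i : Fin T₁.n => T₁.pt i.succ with hl
  have hmeml : ∀ j, T₁.pt j ∈ l := by
    intro j
    rw [hl, List.mem_cons, List.mem_ofFn]
    rcases Fin.eq_zero_or_eq_succ j with rfl | ⟨i, rfl⟩
    · exact Or.inl rfl
    · exact Or.inr ⟨i, rfl⟩
  have hll : chainLength (T₁.pt 0) l (T₁.pt 0) = T₁.length := by
    rw [T₁.length_eq_chainLength, hl, chainLength_cons, dist_self, zero_add]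
  obtain ⟨l', -, hl'V, hl'⟩ := exists_insert_detours S (fun s => H s)
    (fun s => ((V s).image Φ).toList) (T₁.pt 0) (R := R) (by positivity) (d + 1)
    (fun s hs => by
      rw [Finset.length_toList]
      exact Finset.card_image_le.trans (hV s hs).1)
    (fun s hs p hp => by
      rw [Finset.mem_toList] at hp
      obtain ⟨v, hv, rfl⟩ := Finset.mem_image.1 hp
      rw [← hΦi (H s), hΦd]
      exact mul_le_mul_of_nonneg_left ((hV s hs).2.2.2.1 v hv) hrpos.le)
    (fun s hs p hp p' hp' => by
      rw [Finset.mem_toList] at hp hp'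
      obtain ⟨v, hv, rfl⟩ := Finset.mem_image.1 hp
      obtain ⟨v', hv', rfl⟩ := Finset.mem_image.1 hp'
      rw [hΦd]
      exact mul_le_mul_of_nonneg_left ((hV s hs).2.2.2.2 v hv v' hv') hrpos.le)
    l (fun s hs => by
      obtain ⟨j, rfl⟩ := hS hs
      exact hmeml j)
  obtain ⟨pt, hpt1, hpt2⟩ := exists_pt_of_chain (T₁.pt 0) l' l'.length rfl
  let VV : Finset (E d) := S.biUnion fun s => (V s).image Φ
  have hHS : ∀ s ∈ S, H s ∈ convexHull ℝ (VV : Set (E d)) := by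
    intro s hs
    have h1 := Set.mem_image_of_mem Φ (hV s hs).2.2.1
    rw [hΦi, AffineMap.image_convexHull] at h1
    refine convexHull_mono ?_ h1
    intro p hp
    rw [← Finset.coe_image] at hp
    exact Finset.mem_coe.2 (Finset.mem_biUnion.2 ⟨s, hs, hp⟩)
  have hcont : ∀ i, T.pt i ∈ convexHull ℝ (VV : Set (E d)) := by
    intro i
    have h1 := Set.mem_image_of_mem H (happ i)
    rw [AffineMap.image_convexHull] at h1
    have h2 : H (o + (1 + δ)⁻¹ • (T.pt i - o)) = T.pt i := by
      rw [hH, add_sub_cancel_left, smul_smul, mul_inv_cancel₀ hδ'.ne', one_smul, sub_add_cancel]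
    rw [h2] at h1
    refine convexHull_min ?_ (convex_convexHull ℝ _) h1
    rintro _ ⟨s, hs, rfl⟩
    exact hHS s hs
  have hVV : VV.Nonempty := by
    have := (convexHull_nonempty_iff (𝕜 := ℝ)).1 ⟨_, hcont 0⟩
    exact_mod_cast this
  refine ⟨VV, hVV, ?_, hcont, ⟨l'.length, pt⟩, ?_, ?_⟩
  · refine convexHull_grid_mem_polytopes hε hd VV hVV t hrpos fun p hp => ?_
    obtain ⟨s, hs, hp⟩ := Finset.mem_biUnion.1 hp
    obtain ⟨v, hv, rfl⟩ := Finset.mem_image.1 hp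
    exact ⟨v, (hV s hs).2.1 hv, hΦ v⟩
  · intro p hp
    obtain ⟨s, hs, hp⟩ := Finset.mem_biUnion.1 (Finset.mem_coe.1 hp)
    have h1 : p ∈ Set.range pt := by
      rw [hpt1]
      exact List.mem_cons_of_mem _ (hl'V s hs (Finset.mem_toList.2 hp))
    obtain ⟨i, rfl⟩ := h1
    exact Tour.pt_mem_carrier ⟨l'.length, pt⟩ i
  · rw [hpt2]
    refine hl'.trans (le_of_eq ?_)
    rw [hll, hR, hr, hT₁, detourCost]
    push_cast
    ring

/-- A tour through the vertices of a polytope meets every hyperplane that meets the polytope. -/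
lemma Tour.inter_level_nonempty {d : ℕ} (T : Tour d) (V : Finset (E d))
    (hT : vertices (convexHull ℝ (V : Set (E d))) ⊆ T.carrier) {a : E d} {c : ℝ} {x : E d}
    (hx : x ∈ convexHull ℝ (V : Set (E d))) (hxa : x ∈ level a c) :
    (T.carrier ∩ level a c).Nonempty := by
  set P := convexHull ℝ (V : Set (E d)) with hP
  have hPc : IsCompact P := V.finite_toSet.isCompact_convexHull ℝ
  have hfin : (vertices P).Finite := V.finite_toSet.subset extremePoints_convexHull_subset
  have hPv : convexHull ℝ (vertices P) = P := by
    have h : closure (convexHull ℝ (vertices P)) = P :=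
      closure_convexHull_extremePoints hPc (convex_convexHull ℝ _)
    rwa [(hfin.isClosed_convexHull ℝ).closure_eq] at h
  rw [← hPv] at hx
  have hxc : inner ℝ a x = c := hxa
  obtain ⟨v, hv, hvc⟩ : ∃ v ∈ vertices P, inner ℝ a v ≤ c := by
    by_contra! hcon
    have h1 : convexHull ℝ (vertices P) ⊆ {y : E d | c < inner ℝ a y} :=
      convexHull_min (fun w hw => hcon w hw) (convex_halfSpace_gt (innerₛₗ ℝ a).isLinear _)
    exact absurd hxc (h1 hx).ne'
  obtain ⟨v', hv', hvc'⟩ : ∃ v ∈ vertices P, c ≤ inner ℝ a v := by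
    by_contra! hcon
    have h1 : convexHull ℝ (vertices P) ⊆ {y : E d | inner ℝ a y < c} :=
      convexHull_min (fun w hw => hcon w hw) (convex_halfSpace_lt (innerₛₗ ℝ a).isLinear _)
    exact absurd hxc (h1 hx).ne
  obtain ⟨y, hy, hya⟩ := T.isPreconnected_carrier.intermediate_value (hT hv) (hT hv')
    (f := fun y => inner ℝ a y) (by fun_prop) ⟨hvc, hvc'⟩
  exact ⟨y, hy, hya⟩

/-- Every tour lies in a polytope of the base set whose vertices have a tour that is longer by
at most the factor `1 + ε`. -/
lemma exists_polytope_of_tour {ε : ℝ} (hε : 0 < ε) {d : ℕ} (hd : 1 ≤ d) (T : Tour d) :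
    ∃ V : Finset (E d), V.Nonempty ∧ convexHull ℝ (V : Set (E d)) ∈ polytopes (baseSet ε d) ∧
      (∀ i, T.pt i ∈ convexHull ℝ (V : Set (E d))) ∧
      ∃ T' : Tour d, (V : Set (E d)) ⊆ T'.carrier ∧ T'.length ≤ (1 + ε) * T.length := by
  classical
  rcases T.length_nonneg.eq_or_lt with h0 | hpos
  · refine ⟨{T.pt 0}, by simp, ?_, fun i => ?_, T, ?_, ?_⟩
    · refine convexHull_grid_mem_polytopes hε hd _ (by simp) (T.pt 0) one_pos fun v hv => ?_
      rw [Finset.mem_singleton] at hv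
      exact ⟨0, zero_mem_gridPoints ε d, by simp [hv]⟩
    · have h1 := T.two_mul_dist_le_length (T.pt_mem_carrier i) (T.pt_mem_carrier 0)
      have h2 : dist (T.pt i) (T.pt 0) = 0 := le_antisymm (by linarith) dist_nonneg
      simp [dist_eq_zero.1 h2]
    · simpa using T.pt_mem_carrier 0
    · rw [← h0, mul_zero]
  · obtain ⟨S, hSW, o, δ, hδ, happ, hcost⟩ := exists_cheap_approximation hε hd
      (Finset.univ.image T.pt) (Finset.univ_nonempty.image _)
    obtain ⟨V, hVne, hVP, hVT, T', hT', hlen⟩ := exists_rounded_polytope hε hd T hpos S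
      (fun s hs => by simpa using hSW hs) o hδ
      (fun i => happ _ (Finset.mem_image_of_mem _ (Finset.mem_univ i)))
    exact ⟨V, hVne, hVP, hVT, T', hT', hlen.trans (by gcongr)⟩

end HyperplaneTSPN

theorem lemma3p6 (d : ℕ) (hd : 1 ≤ d) (ε : ℝ) (hε : 0 < ε)
    (I : Set (Set (HyperplaneTSPN.E d))) (hfin : I.Finite)
    (hI : ∀ h ∈ I, HyperplaneTSPN.IsHyperplane h) :
    (∃ T : HyperplaneTSPN.Tour d, HyperplaneTSPN.IsOptimalTour I T) ∧
    ∃ P ∈ HyperplaneTSPN.polytopes (HyperplaneTSPN.baseSet ε d),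
      P.Nonempty ∧
      (∃ T' : HyperplaneTSPN.Tour d,
        HyperplaneTSPN.IsShortestTour (HyperplaneTSPN.vertices P) T') ∧
      ∀ T' : HyperplaneTSPN.Tour d,
        HyperplaneTSPN.IsShortestTour (HyperplaneTSPN.vertices P) T' →
          T'.Feasible I ∧
          ∀ T : HyperplaneTSPN.Tour d, HyperplaneTSPN.IsOptimalTour I T →
            T'.length ≤ (1 + ε) * T.length := by
  obtain ⟨T, hT⟩ := HyperplaneTSPN.exists_isOptimalTour I hfin hI
  obtain ⟨V, hVne, hVP, hVT, T₂, hT₂, hlen⟩ := HyperplaneTSPN.exists_polytope_of_tour hε hd T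
  have hvV : HyperplaneTSPN.vertices (convexHull ℝ (V : Set (HyperplaneTSPN.E d))) ⊆ V :=
    extremePoints_convexHull_subset
  refine ⟨⟨T, hT⟩, _, hVP, hVne.to_set.convexHull, ?_, fun T' hT' => ⟨fun h hh => ?_, ?_⟩⟩
  · have := HyperplaneTSPN.exists_isShortestTour (V.finite_toSet.subset hvV).toFinset
    rwa [Set.Finite.coe_toFinset] at this
  · obtain ⟨a, c, -, rfl⟩ := hI h hh
    obtain ⟨x, hxT, hx⟩ := hT.1 _ hh
    refine T'.inter_level_nonempty V hT'.1 ?_ hx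
    refine convexHull_min ?_ (convex_convexHull ℝ _) (T.carrier_subset_convexHull hxT)
    rintro _ ⟨i, rfl⟩
    exact hVT i
  · intro S hS
    have h1 := hT'.2 T₂ (hvV.trans hT₂)
    have h2 := hT.2 S hS.1
    refine h1.trans (hlen.trans ?_)
    gcongr
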